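/- Let $(X,d)$ be a finite (pseudo)metric space with $n$ points, and let $\delta_{\mathrm{diam}}(A)=\max_{x,y\in A}d(x,y)$ for $A\subseteq X$ (with value $0$ for $A=\emptyset$) be its diameter diversity. Let $\delta_1(B)=\sum_{i=1}^k\max_{a,b\in B}|a_i-b_i|$, for finite $B\subset\mathbb{R}^k$, be the $\ell_1$ diversity on $\mathbb{R}^k$. A map $f:X\to\mathbb{R}^k$ is an embedding of $(X,\delta_{\mathrm{diam}})$ into $(\mathbb{R}^k,\delta_1)$ with distortion $c$ if $c=c_1c_2$ for some $c_1,c_2\ge 1$ such that $\frac1{c_1}\delta_{\mathrm{diam}}(A)\le\delta_1(f(A))\le c_2\,\delta_{\mathrm{diam}}(A)$ for all $A\subseteq X$. There are a universal constant $C>0$, a polynomial $T$, and a single randomized algorithm which, given $n$ and the matrix $(d(x,y))_{x,y\in X}$ of any such space, has the following properties. 1. For every outcome of the coin tosses, it halts after at most $T(n)$ steps and outputs a dimension $k\le C\log^2 n$ and a map $f:X\to\mathbb{R}^k$ that is a scaled Fréchet embedding: there are a number $L\ge 1$ with $k\le L\le\max\{1,C\log^2 n\}$ and nonempty sets $A_1,\dots,A_k\subseteq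 X$ such that $f_i(x)=\frac1L\min_{y\in A_i}d(x,y)$ for all $x\in X$ and $1\le i\le k$. 2. With probability at least $1-\frac1{n+1}$ over the coin tosses, $f$ is an embedding of $(X,\delta_{\mathrm{diam}})$ into $(\mathbb{R}^k,\delta_1)$ with distortion at most $\max\{1,C\log n\}$. Here an algorithm is a program for a random access machine with unit-cost steps, whose memory consists of natural-number registers (usable as addresses), real registers, and a two-dimensional output array of reals. A step is: setting a natural-number register to a constant of the program, adding or subtracting natural numbers (subtraction truncated at $0$), adding or subtracting reals, halving a real, moving a number (with direct or indirect addressing), comparing two numbers of the same kind, tossing a fair coin, reading one entry $d(x,y)$ of the input, or writing one real to the output. (For $n\in\{0,1\}$, read $\log^2 n$ and $\log n$ as $0$.) -/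

import Mathlib

open MeasureTheory

/-! ### Diversities -/

/-- A (pseudo) diversity on `X`: a real function of the finite subsets of `X` that is nonnegative,
vanishes on sets with at most one element, and satisfies the triangle inequality. -/
structure PseudoDiversity (X : Type*) where
  δ : Finset X → ℝ
  nonneg : ∀ A, 0 ≤ δ A
  eq_zero : ∀ A, A.card ≤ 1 → δ A = 0
  triangle : open Classical in
    ∀ A B C : Finset X, C.Nonempty → δ (A ∪ B) ≤ δ (A ∪ C) + δ (B ∪ C)

open Classical in
/-- The maximum of `g a b` over `a, b ∈ A` (with value `0` for the empty set). -/
noncomputable def maxPairs {X : Type*} (g : X → X → ℝ) (A : Finset X) : ℝ :=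
  if h : A.Nonempty then (A ×ˢ A).sup' (h.product h) (fun p => g p.1 p.2) else 0

theorem maxPairs_le {X : Type*} {g : X → X → ℝ} {A : Finset X} {c : ℝ} (hc : 0 ≤ c)
    (h : ∀ a ∈ A, ∀ b ∈ A, g a b ≤ c) : maxPairs g A ≤ c := by
  unfold maxPairs
  split_ifs with hA
  · refine Finset.sup'_le _ _ fun p hp => ?_
    rw [Finset.mem_product] at hp
    exact h _ hp.1 _ hp.2
  · exact hc

theorem le_maxPairs {X : Type*} (g : X → X → ℝ) {A : Finset X} {a b : X} (ha : a ∈ A)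
    (hb : b ∈ A) : g a b ≤ maxPairs g A := by
  unfold maxPairs
  rw [dif_pos ⟨a, ha⟩]
  exact Finset.le_sup' (fun p : X × X => g p.1 p.2) (Finset.mk_mem_product ha hb)

theorem maxPairs_nonneg {X : Type*} {g : X → X → ℝ} (g0 : ∀ a, g a a = 0) (A : Finset X) :
    0 ≤ maxPairs g A := by
  rcases A.eq_empty_or_nonempty with rfl | ⟨a, ha⟩
  · simp [maxPairs]
  · exact (g0 a).symm.le.trans (le_maxPairs g ha ha)

theorem maxPairs_eq_zero {X : Type*} {g : X → X → ℝ} (g0 : ∀ a, g a a = 0) (A : Finset X)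
    (hA : A.card ≤ 1) : maxPairs g A = 0 := by
  refine le_antisymm (maxPairs_le le_rfl fun a ha b hb => ?_) (maxPairs_nonneg g0 A)
  rw [Finset.card_le_one.1 hA a ha b hb, g0]

open Classical in
theorem maxPairs_triangle {X : Type*} {g : X → X → ℝ} (g0 : ∀ a, g a a = 0)
    (gs : ∀ a b, g a b = g b a) (gt : ∀ a b c, g a c ≤ g a b + g b c)
    (A B C : Finset X) (hC : C.Nonempty) :
    maxPairs g (A ∪ B) ≤ maxPairs g (A ∪ C) + maxPairs g (B ∪ C) := by
  obtain ⟨c, hc⟩ := hC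
  have hA := maxPairs_nonneg g0 (A ∪ C)
  have hB := maxPairs_nonneg g0 (B ∪ C)
  have cross : ∀ a ∈ A, ∀ b ∈ B, g a b ≤ maxPairs g (A ∪ C) + maxPairs g (B ∪ C) := by
    intro a ha b hb
    have h1 := le_maxPairs g (Finset.mem_union_left C ha) (Finset.mem_union_right A hc)
    have h2 := le_maxPairs g (Finset.mem_union_right B hc) (Finset.mem_union_left C hb)
    linarith [gt a c b]
  refine maxPairs_le (by linarith) fun a ha b hb => ?_
  rcases Finset.mem_union.1 ha with ha | ha <;> rcases Finset.mem_union.1 hb with hb | hb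
  · linarith [le_maxPairs g (Finset.mem_union_left C ha) (Finset.mem_union_left C hb)]
  · exact cross a ha b hb
  · rw [gs]
    exact cross b hb a ha
  · linarith [le_maxPairs g (Finset.mem_union_left C ha) (Finset.mem_union_left C hb)]

/-- The diameter diversity of a (pseudo) metric space: `δ(A) = max_{x, y ∈ A} d(x, y)`. -/
noncomputable def diamDiversity (X : Type*) [PseudoMetricSpace X] : PseudoDiversity X where
  δ := maxPairs dist
  nonneg := maxPairs_nonneg dist_self
  eq_zero := maxPairs_eq_zero dist_self
  triangle := maxPairs_triangle dist_self dist_comm dist_triangle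

/-- The `ℓ₁` diversity on `ℝ^k`: `δ₁(A) = ∑ i, max_{a, b ∈ A} |a i - b i|`. -/
noncomputable def l1Diversity (k : ℕ) : PseudoDiversity (Fin k → ℝ) where
  δ A := ∑ i, maxPairs (fun a b => |a i - b i|) A
  nonneg A := Finset.sum_nonneg fun i _ => maxPairs_nonneg (g := fun a b => |a i - b i|) (by simp) A
  eq_zero A hA := Finset.sum_eq_zero fun i _ =>
    maxPairs_eq_zero (g := fun a b => |a i - b i|) (by simp) A hA
  triangle A B C hC := by
    rw [← Finset.sum_add_distrib]
    exact Finset.sum_le_sum fun i _ => maxPairs_triangle (g := fun a b => |a i - b i|) (by simp)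
      (fun a b => abs_sub_comm _ _) (fun a b c => abs_sub_le _ _ _) A B C hC

open Classical in
/-- `f` is an embedding of the diversity `S` into the diversity `T` with distortion `c`. -/
def IsDiversityEmbedding {X Y : Type*} (S : PseudoDiversity X) (T : PseudoDiversity Y)
    (f : X → Y) (c : ℝ) : Prop :=
  ∃ c₁ c₂ : ℝ, 1 ≤ c₁ ∧ 1 ≤ c₂ ∧ c = c₁ * c₂ ∧
    ∀ A : Finset X, 1 / c₁ * S.δ A ≤ T.δ (A.image f) ∧ T.δ (A.image f) ≤ c₂ * S.δ A

/-- `f` is a Fréchet embedding scaled by `r`: every coordinate of `f` has the form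
`x ↦ r * min_{y ∈ A} d(x, y)` for some nonempty finite set `A`. -/
def IsScaledFrechet {X : Type*} [PseudoMetricSpace X] {k : ℕ} (r : ℝ) (f : X → Fin k → ℝ) : Prop :=
  ∀ i : Fin k, ∃ (A : Finset X) (hA : A.Nonempty),
    ∀ x, f x i = r * A.inf' hA (fun y => dist x y)

/-! ### Randomized real random access machines

The machine has read access to an `n × n` matrix `d` of real numbers and to a sequence of coin
tosses. Its memory consists of infinitely many index registers, which hold natural numbers,
infinitely many real registers, and a doubly indexed output array of reals. Index registers may be
used as addresses, in either memory. The arithmetic is restricted to addition, subtraction,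
comparison, and halving of reals, and the only constants are natural numbers written in the program.
Without multiplications, `t` steps on rational data produce numbers whose bit length is bounded
by the bit length of the data plus `O(t)`, so unit costs do not hide any work. -/

namespace RealRAM

structure State where
  /-- index registers -/
  idx : ℕ → ℕ
  /-- real registers -/
  val : ℕ → ℝ
  /-- output array -/
  out : ℕ → ℕ → ℝ
  /-- number of coins tossed so far -/
  coins : ℕ

inductive Instr where
  /-- `idx[i] := c` -/
  | const (i c : ℕ)
  /-- `idx[i] := idx[j] + idx[k]` -/
  | plus (i j k : ℕ)
  /-- `idx[i] := idx[j] - idx[k]`, truncated at `0` -/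
  | minus (i j k : ℕ)
  /-- `idx[i] := idx[idx[j]]` -/
  | load (i j : ℕ)
  /-- `idx[idx[i]] := idx[j]` -/
  | store (i j : ℕ)
  /-- `idx[i] :=` the next coin toss, `0` or `1` -/
  | toss (i : ℕ)
  /-- `val[i] := d(idx[j], idx[k])`, or `0` if an index is out of range -/
  | query (i j k : ℕ)
  /-- `val[i] := val[j] + val[k]` -/
  | rplus (i j k : ℕ)
  /-- `val[i] := val[j] - val[k]` -/
  | rminus (i j k : ℕ)
  /-- `val[i] := val[j] / 2` -/
  | rhalf (i j : ℕ)
  /-- `val[i] := val[idx[j]]` -/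
  | rload (i j : ℕ)
  /-- `val[idx[i]] := val[j]` -/
  | rstore (i j : ℕ)
  /-- `out[idx[i], idx[j]] := val[k]` -/
  | emit (i j k : ℕ)

inductive Test where
  /-- `idx[i] < idx[j]` -/
  | idxLt (i j : ℕ)
  /-- `val[i] < val[j]` -/
  | valLt (i j : ℕ)

inductive Program where
  | instr (a : Instr)
  | seq (p q : Program)
  | cond (b : Test) (p q : Program)
  | loop (b : Test) (p : Program)

/-- The entry `d(u, v)` of the input matrix, or `0` if an index is out of range. -/
noncomputable def entry {n : ℕ} (d : Fin n → Fin n → ℝ) (u v : ℕ) : ℝ :=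
  if h : u < n ∧ v < n then d ⟨u, h.1⟩ ⟨v, h.2⟩ else 0

open Function in
/-- The effect of one instruction, for the input matrix `d` and the coin tosses `ω`. -/
noncomputable def Instr.step {n : ℕ} (d : Fin n → Fin n → ℝ) (ω : ℕ → Bool) (s : State) :
    Instr → State
  | .const i c => { s with idx := update s.idx i c }
  | .plus i j k => { s with idx := update s.idx i (s.idx j + s.idx k) }
  | .minus i j k => { s with idx := update s.idx i (s.idx j - s.idx k) }
  | .load i j => { s with idx := update s.idx i (s.idx (s.idx j)) }
  | .store i j => { s with idx := update s.idx (s.idx i) (s.idx j) }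
  | .toss i =>
    { s with idx := update s.idx i (Bool.toNat (ω s.coins)), coins := (s.coins + 1) }
  | .query i j k =>
    { s with val := update s.val i (entry d (s.idx j) (s.idx k)) }
  | .rplus i j k => { s with val := update s.val i (s.val j + s.val k) }
  | .rminus i j k => { s with val := update s.val i (s.val j - s.val k) }
  | .rhalf i j => { s with val := update s.val i (s.val j / 2) }
  | .rload i j => { s with val := update s.val i (s.val (s.idx j)) }
  | .rstore i j => { s with val := update s.val (s.idx i) (s.val j) }
  | .emit i j k =>
    { s with out := update s.out (s.idx i) (update (s.out (s.idx i)) (s.idx j) (s.val k)) }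

def Test.holds (s : State) : Test → Prop
  | .idxLt i j => s.idx i < s.idx j
  | .valLt i j => s.val i < s.val j

/-- `Exec d ω p s t s'`: on input `d` with coin tosses `ω`, the program `p` started in the state `s`
halts in the state `s'` after `t` steps. Every instruction and every evaluation of a test is one
step. -/
inductive Exec {n : ℕ} (d : Fin n → Fin n → ℝ) (ω : ℕ → Bool) :
    Program → State → ℕ → State → Prop where
  | instr (a : Instr) (s : State) : Exec d ω (.instr a) s 1 (a.step d ω s)
  | seq {p q : Program} {s s' s'' : State} {t t' : ℕ} :
      Exec d ω p s t s' → Exec d ω q s' t' s'' → Exec d ω (.seq p q) s (t + t') s''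
  | condTrue {b : Test} {p q : Program} {s s' : State} {t : ℕ} :
      b.holds s → Exec d ω p s t s' → Exec d ω (.cond b p q) s (t + 1) s'
  | condFalse {b : Test} {p q : Program} {s s' : State} {t : ℕ} :
      ¬ b.holds s → Exec d ω q s t s' → Exec d ω (.cond b p q) s (t + 1) s'
  | loopTrue {b : Test} {p : Program} {s s' s'' : State} {t t' : ℕ} :
      b.holds s → Exec d ω p s t s' → Exec d ω (.loop b p) s' t' s'' →
        Exec d ω (.loop b p) s (t + t' + 1) s''
  | loopFalse {b : Test} {p : Program} {s : State} :
      ¬ b.holds s → Exec d ω (.loop b p) s 1 s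

/-- The execution is deterministic once the coin tosses are fixed. -/
theorem Exec.unique {n : ℕ} {d : Fin n → Fin n → ℝ} {ω : ℕ → Bool} {p : Program}
    {s s₁ s₂ : State} {t₁ t₂ : ℕ} (h₁ : Exec d ω p s t₁ s₁) (h₂ : Exec d ω p s t₂ s₂) :
    t₁ = t₂ ∧ s₁ = s₂ := by
  induction h₁ generalizing t₂ s₂ with
  | instr a s => cases h₂; exact ⟨rfl, rfl⟩
  | seq _ _ ih ih' =>
    cases h₂ with
    | seq g g' =>
      obtain ⟨rfl, rfl⟩ := ih g
      obtain ⟨rfl, rfl⟩ := ih' g'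
      exact ⟨rfl, rfl⟩
  | condTrue hb _ ih =>
    cases h₂ with
    | condTrue _ g => obtain ⟨rfl, rfl⟩ := ih g; exact ⟨rfl, rfl⟩
    | condFalse hb' _ => exact absurd hb hb'
  | condFalse hb _ ih =>
    cases h₂ with
    | condTrue hb' _ => exact absurd hb' hb
    | condFalse _ g => obtain ⟨rfl, rfl⟩ := ih g; exact ⟨rfl, rfl⟩
  | loopTrue hb _ _ ih ih' =>
    cases h₂ with
    | loopTrue _ g g' =>
      obtain ⟨rfl, rfl⟩ := ih g
      obtain ⟨rfl, rfl⟩ := ih' g'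
      exact ⟨rfl, rfl⟩
    | loopFalse hb' => exact absurd hb hb'
  | loopFalse hb =>
    cases h₂ with
    | loopTrue hb' _ _ => exact absurd hb' hb
    | loopFalse _ => exact ⟨rfl, rfl⟩

/-- The initial state on an `n × n` input: `idx[0] = n`, and everything else is `0`. -/
def init (n : ℕ) : State where
  idx := Function.update (fun _ => 0) 0 n
  val := fun _ => 0
  out := fun _ _ => 0
  coins := 0

/-- The dimension that a final state announces, in `idx[0]`. -/
def State.dim (s : State) : ℕ := s.idx 0

/-- The map into `ℝ^k`, `k = s.dim`, that a final state describes: the image of the point `x`, which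
has the number `e x`, is the row `e x` of the output array. -/
def State.map {X : Type*} {n : ℕ} (s : State) (e : X ≃ Fin n) : X → Fin s.dim → ℝ :=
  fun x i => s.out (e x) i

/-- The law of a sequence of independent fair coin tosses. -/
noncomputable def coinMeasure : Measure (ℕ → Bool) :=
  Measure.infinitePi fun _ => (PMF.uniformOfFintype Bool).toMeasure

end RealRAM

/-! This is Bourgain's embedding with explicit coins. Let `J = Nat.clog 2 n`. In each of `256 * J`
rounds every point tosses `J` coins; level set `t` consists of the points whose first `t + 1` coins
are heads, a random set of density `2^-(t+1)`. The coordinates are the distances to these sets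
divided by `L = 2^H`, the least power of two that is at least the dimension `256 * J * J`; a power
of two, because the machine can halve but not divide.

Every coordinate is `1/L`-Lipschitz and there are at most `L` of them, so the ℓ₁ diversity of an
image never exceeds the diameter. Conversely, a diameter is attained at a pair, so the lower bound
only concerns pairs (`isDiversityEmbedding_of_lipschitz`). For a pair `x, y`, `exists_radii` splits
`d(x, y) / 2` into increments `ρ (t + 1) - ρ t`; a positive one is witnessed by any set that hits a
certain ball of at least `2^t` points and misses a disjoint one of at most `2^(t+1)` points. Level
set `t` does this with probability at least 1/12 (`card_hit_miss`). An exponential moment bound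
(`card_few_good`) and a union bound over pairs and levels show that, with the required probability,
every increment is witnessed in at least `8 * J` rounds. Telescoping, the coordinates differ in
total by at least `4 J d(x, y) / L`, which is at least `d(x, y) / (128 J)`.

That the program computes this map in polynomial time is shown by loop invariants that carry the
step count (`Halts.loop`), culminating in `halts_embed`. -/

namespace RealRAM

/-! ### A Hoare calculus with running times -/

/-- The program `p`, started in the state `s`, halts after at most `T` steps, in a state that
satisfies `Q`. -/
def Halts {n : ℕ} (d : Fin n → Fin n → ℝ) (ω : ℕ → Bool) (p : Program) (s : State) (T : ℕ)
    (Q : State → Prop) : Prop :=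
  ∃ (t : ℕ) (s' : State), Exec d ω p s t s' ∧ t ≤ T ∧ Q s'

/-- The program that executes the instructions of a nonempty list. -/
def block (a : Instr) : List Instr → Program
  | [] => .instr a
  | b :: l => .seq (.instr a) (block b l)

section

variable {n : ℕ} {d : Fin n → Fin n → ℝ} {ω : ℕ → Bool} {p q : Program} {s : State} {T T' : ℕ}
  {Q Q' : State → Prop}

theorem Halts.mono (h : Halts d ω p s T Q) (hT : T ≤ T') (hQ : ∀ s', Q s' → Q' s') :
    Halts d ω p s T' Q' := by
  obtain ⟨t, s', h, ht, hs⟩ := h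
  exact ⟨t, s', h, ht.trans hT, hQ _ hs⟩

theorem Halts.seq (hp : Halts d ω p s T Q') (hq : ∀ s', Q' s' → Halts d ω q s' T' Q) :
    Halts d ω (.seq p q) s (T + T') Q := by
  obtain ⟨t, s', h, ht, hs⟩ := hp
  obtain ⟨t', s'', h', ht', hs'⟩ := hq s' hs
  exact ⟨_, _, .seq h h', by omega, hs'⟩

theorem Halts.block {a : Instr} {l : List Instr}
    (h : Q ((a :: l).foldl (fun s a => a.step d ω s) s)) :
    Halts d ω (block a l) s (l.length + 1) Q := by
  induction l generalizing a s with
  | nil => exact ⟨_, _, .instr a s, by simp, h⟩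
  | cons b l ih =>
    obtain ⟨t, s', h', ht', hs'⟩ := ih (a := b) (s := a.step d ω s) h
    exact ⟨_, _, .seq (.instr a s) h', by simp; omega, hs'⟩

theorem Halts.cond {b : Test} (hp : b.holds s → Halts d ω p s T Q)
    (hq : ¬ b.holds s → Halts d ω q s T Q) : Halts d ω (.cond b p q) s (T + 1) Q := by
  by_cases hb : b.holds s
  · obtain ⟨t, s', h, ht, hs⟩ := hp hb
    exact ⟨_, _, .condTrue hb h, by omega, hs⟩
  · obtain ⟨t, s', h, ht, hs⟩ := hq hb
    exact ⟨_, _, .condFalse hb h, by omega, hs⟩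

/-- The invariant is indexed by the number of completed iterations, so it also forces the loop to
stop after exactly `N` of them. Each iteration pays one step for its test; the final `+ 1` is the
failing test. -/
theorem Halts.loop {b : Test} (I : ℕ → State → Prop) (N : ℕ) (h0 : I 0 s)
    (hstep : ∀ j s', j < N → I j s' → b.holds s' ∧ Halts d ω p s' T (I (j + 1)))
    (hend : ∀ s', I N s' → ¬ b.holds s' ∧ Q s') :
    Halts d ω (.loop b p) s (N * (T + 1) + 1) Q := by
  have key : ∀ m j s', j + m = N → I j s' →
      Halts d ω (.loop b p) s' (m * (T + 1) + 1) Q := by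
    intro m
    induction m with
    | zero =>
      intro j s' hj hI
      obtain rfl : j = N := by omega
      exact ⟨_, _, .loopFalse (hend _ hI).1, by omega, (hend _ hI).2⟩
    | succ m ih =>
      intro j s' hj hI
      obtain ⟨hb, t, s₁, h, ht, hs⟩ := hstep j s' (by omega) hI
      obtain ⟨t', s₂, h', ht', hs'⟩ := ih (j + 1) s₁ (by omega) hs
      refine ⟨_, _, .loopTrue hb h h', ?_, hs'⟩
      rw [Nat.succ_mul]
      omega
  exact key N 0 s (by omega) h0

end

/-! ### The program -/

/-- The number of leading `true`s among the first `l` terms of `a`. -/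
def lead (a : ℕ → Bool) : ℕ → ℕ
  | 0 => 0
  | l + 1 => if lead a l < l then lead a l else lead a l + (a l).toNat

/-- The recursion mirrors the machine's counter: while it equals the position, all terms so far were
`true`; once it lags behind, a `false` has occurred and it is frozen. -/
theorem lead_spec (a : ℕ → Bool) (l : ℕ) :
    lead a l ≤ l ∧ ∀ t < l, (t < lead a l ↔ ∀ m ≤ t, a m = true) := by
  induction l with
  | zero => simp [lead]
  | succ l ih =>
    obtain ⟨h1, h2⟩ := ih
    rw [lead]
    split_ifs with h
    · refine ⟨by omega, fun t ht => ?_⟩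
      rcases Nat.lt_succ_iff_lt_or_eq.1 ht with ht | rfl
      · exact h2 t ht
      · have h3 := (h2 _ h).not.1 (lt_irrefl _)
        push Not at h3
        obtain ⟨m, hm, hm'⟩ := h3
        refine iff_of_false (by omega) fun h4 => hm' (h4 m (by omega))
    · have hl : lead a l = l := by omega
      rw [hl] at h2 ⊢
      have h3 := Bool.toNat_le (a l)
      refine ⟨by omega, fun t ht => ?_⟩
      rcases Nat.lt_succ_iff_lt_or_eq.1 ht with ht | rfl
      · rw [← h2 t ht]
        omega
      · have h4 : ∀ m < t, a m = true := fun m hm => (h2 m hm).1 hm m le_rfl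
        constructor
        · intro h5 m hm
          rcases hm.lt_or_eq with hm | rfl
          · exact h4 m hm
          · cases h6 : a m
            · simp [h6] at h5
            · rfl
        · intro h5
          simp [h5 t le_rfl]

/-- The minimum of `w` on `S`, or `0` if `S` is empty. -/
noncomputable def minOver (w : ℕ → ℝ) (S : Finset ℕ) : ℝ :=
  if h : S.Nonempty then S.inf' h w else 0

theorem minOver_empty (w : ℕ → ℝ) : minOver w ∅ = 0 := by simp [minOver]

theorem minOver_singleton (w : ℕ → ℝ) (a : ℕ) : minOver w {a} = w a := by simp [minOver]

theorem minOver_insert (w : ℕ → ℝ) (a : ℕ) (S : Finset ℕ) (hS : S.Nonempty) :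
    minOver w (insert a S) = min (w a) (minOver w S) := by
  simp [minOver, hS, Finset.inf'_insert]

/- Index registers: `0` holds `n`, `1` holds `1`, `3` the number `J` of levels, `4` the number `R`
of rounds, `5` the dimension, `6` the scale, `7` the round, `8` a point, `11` a number of leading
ones, `13` a level, `14` a point, `17` a column, `19` the address `32` of an array that holds a
number of leading ones for each point. -/

/-- Tosses `J` coins and counts the leading ones. -/
def tossLead : Program :=
  .seq (block (.const 9 0) [.const 11 0]) <|
  .loop (.idxLt 9 3) <| .seq (block (.toss 10) []) <|
  .cond (.idxLt 11 9) (block (.plus 9 9 1) []) (block (.plus 11 11 10) [.plus 9 9 1])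

/-- Counts leading ones for every point. -/
def sample : Program :=
  .seq (block (.const 8 0) []) <|
  .loop (.idxLt 8 0) <| .seq tossLead <| block (.plus 12 19 8) [.store 12 11, .plus 8 8 1]

/-- Computes the distance from a point to the random set of a level. -/
def scan : Program :=
  -- No instruction loads a real constant, so zero is obtained by self-subtraction. Index register
  -- 15 flags that a member of the set has been seen.
  .seq (block (.rminus 0 0 0) [.const 15 0, .const 14 0]) <|
  .loop (.idxLt 14 0) <|
  .seq (block (.plus 12 19 14) [.load 10 12, .query 1 8 14]) <|
  .seq (.cond (.idxLt 13 10)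
    (.cond (.idxLt 15 1) (block (.rminus 0 0 0) [.rplus 0 0 1, .const 15 1])
      -- Programs cannot be empty; overwriting the scratch register 12 serves as a no-op.
      (.cond (.valLt 1 0) (block (.rminus 0 0 0) [.rplus 0 0 1]) (block (.const 12 0) [])))
    (block (.const 12 0) [])) <|
  block (.plus 14 14 1) []

/-- Divides a real register by the scale. -/
def rescale : Program :=
  .seq (block (.const 16 1) []) <|
  .loop (.idxLt 16 6) <| block (.rhalf 0 0) [.plus 16 16 16]

/-- Writes one column of the output. -/
def column : Program :=
  .seq (block (.const 8 0) []) <|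
  .loop (.idxLt 8 0) <| .seq scan <| .seq rescale <| block (.emit 8 17 0) [.plus 8 8 1]

/-- Writes the columns of one round. -/
def columns : Program :=
  .seq (block (.const 13 0) []) <|
  .loop (.idxLt 13 3) <| .seq column <| block (.plus 17 17 1) [.plus 13 13 1]

/-- Writes the columns of all rounds. -/
def rounds : Program :=
  .seq (block (.const 7 0) [.const 17 0]) <|
  .loop (.idxLt 7 4) <| .seq sample <| .seq columns <| block (.plus 7 7 1) []

/-- Computes the parameters. -/
def parameters : Program :=
  .seq (block (.const 1 1) [.const 19 32, .const 2 1, .const 3 0]) <|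
  .seq (.loop (.idxLt 2 0) (block (.plus 2 2 2) [.plus 3 3 1])) <|
  -- Eight doublings give `256 * J`; the product with `J` is then formed by repeated addition.
  .seq (block (.plus 4 3 3) [.plus 4 4 4, .plus 4 4 4, .plus 4 4 4, .plus 4 4 4, .plus 4 4 4,
    .plus 4 4 4, .plus 4 4 4, .const 5 0, .const 7 0]) <|
  .seq (.loop (.idxLt 7 4) (block (.plus 5 5 3) [.plus 7 7 1])) <|
  .seq (block (.const 6 1) []) <|
  .loop (.idxLt 6 5) (block (.plus 6 6 6) [])

/-- The randomized embedding algorithm. -/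
def embed : Program :=
  .seq parameters <| .seq rounds <| block (.const 18 0) [.plus 0 5 18]

/-! ### Correctness and running time of the program -/

section

variable {n : ℕ} {d : Fin n → Fin n → ℝ} {ω : ℕ → Bool} {s : State}

/-- Here and below, a specification also records which parts of the state survive, since the
callers' loop invariants depend on them. -/
theorem halts_tossLead (h1 : s.idx 1 = 1) :
    Halts d ω tossLead s (s.idx 3 * 5 + 3) fun s' =>
      (∀ j, j ≠ 9 → j ≠ 10 → j ≠ 11 → s'.idx j = s.idx j) ∧
      s'.idx 11 = lead (fun l => ω (s.coins + l)) (s.idx 3) ∧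
      s'.val = s.val ∧ s'.out = s.out ∧ s'.coins = s.coins + s.idx 3 := by
  refine Halts.mono (Halts.seq (T' := s.idx 3 * (4 + 1) + 1) (Halts.block (Q := fun s' =>
    (∀ j, j ≠ 9 → j ≠ 10 → j ≠ 11 → s'.idx j = s.idx j) ∧ s'.idx 9 = 0 ∧ s'.idx 11 = 0 ∧
      s'.val = s.val ∧ s'.out = s.out ∧ s'.coins = s.coins) ?_) ?_) (by simp; omega)
      fun _ h => h
  · simp +contextual [Instr.step]
  rintro s₁ ⟨hf, h9, h11, hv, ho, hc⟩
  refine Halts.loop (fun l s' => (∀ j, j ≠ 9 → j ≠ 10 → j ≠ 11 → s'.idx j = s.idx j) ∧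
    s'.idx 9 = l ∧ s'.idx 11 = lead (fun l => ω (s.coins + l)) l ∧
    s'.val = s.val ∧ s'.out = s.out ∧ s'.coins = s.coins + l) _ ?_ ?_ ?_
  · exact ⟨hf, h9, h11, hv, ho, hc⟩
  · rintro l s' hl ⟨hf, h9, h11, hv, ho, hc⟩
    refine ⟨by simpa [Test.holds, h9, hf 3] using hl, ?_⟩
    -- The intermediate postcondition is equality with the computed state, so the block is executed
    -- symbolically.
    refine Halts.seq (T := 1) (T' := 3) (Halts.block rfl) ?_
    rintro _ rfl
    refine Halts.cond (T := 2) (fun h => Halts.mono (Halts.block ?_) (by simp) fun _ h => h)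
      (fun h => Halts.block ?_)
    · simp [Test.holds, Instr.step, h9, h11] at h
      simp +contextual [Instr.step, *, lead, add_assoc]
    · simp [Test.holds, Instr.step, h9, h11] at h
      simp +contextual [Instr.step, *, lead, add_assoc, not_lt.2 h]
  · rintro s' ⟨hf, h9, h11, hv, ho, hc⟩
    exact ⟨by simp [Test.holds, h9, hf 3], hf, h11, hv, ho, hc⟩

theorem halts_sample (h0 : s.idx 0 = n) (h1 : s.idx 1 = 1) (h19 : s.idx 19 = 32) :
    Halts d ω sample s (n * (s.idx 3 * 5 + 7) + 2) fun s' =>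
      (∀ j < 32, j < 8 ∨ 12 < j → s'.idx j = s.idx j) ∧
      (∀ x < n, s'.idx (32 + x) =
        lead (fun l => ω (s.coins + x * s.idx 3 + l)) (s.idx 3)) ∧
      s'.val = s.val ∧ s'.out = s.out ∧ s'.coins = s.coins + n * s.idx 3 := by
  refine Halts.mono (Halts.seq (T' := n * (s.idx 3 * 5 + 3 + 3 + 1) + 1) (Halts.block rfl) ?_)
    (by simp; linarith) fun _ h => h
  rintro _ rfl
  refine Halts.loop (fun x s' => s'.idx 8 = x ∧ (∀ j < 32, j < 8 ∨ 12 < j → s'.idx j = s.idx j) ∧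
      (∀ y < x, s'.idx (32 + y) = lead (fun l => ω (s.coins + y * s.idx 3 + l)) (s.idx 3)) ∧
      s'.val = s.val ∧ s'.out = s.out ∧ s'.coins = s.coins + x * s.idx 3) _ ?_ ?_ ?_
  · simp [Instr.step]
    intro j hj h
    rw [Function.update_of_ne (by omega)]
  · rintro x s' hx ⟨h8, hf, hl, hv, ho, hc⟩
    refine ⟨by simpa [Test.holds, h8, hf 0, h0] using hx, ?_⟩
    have e3 := hf 3 (by simp) (by simp)
    have H := halts_tossLead (d := d) (ω := ω) (s := s') (by rw [hf 1 (by simp) (by simp), h1])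
    rw [e3] at H
    refine Halts.seq (T' := 3) H ?_
    rintro s₂ ⟨gf, g11, gv, go, gc⟩
    have g8 : s₂.idx 8 = x := by rw [gf 8 (by simp) (by simp) (by simp), h8]
    have g1 : s₂.idx 1 = 1 := by
      rw [gf 1 (by simp) (by simp) (by simp), hf 1 (by simp) (by simp), h1]
    have g19 : s₂.idx 19 = 32 := by
      rw [gf 19 (by simp) (by simp) (by simp), hf 19 (by simp) (by simp), h19]
    refine Halts.block ⟨?_, ?_, ?_, ?_, ?_, ?_⟩
    · simp [Instr.step, Function.update_apply, *]
      rw [if_neg (by omega), if_neg (by omega)]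
    · intro j hj h
      simp [Instr.step, Function.update_apply, *]
      rw [if_neg (by omega), if_neg (by omega), if_neg (by omega), gf _ (by omega) (by omega)
        (by omega), hf j hj h]
    · intro y hy
      simp only [List.foldl, Instr.step, Function.update_apply, g8, g1, g19, if_true]
      rw [if_neg (by omega)]
      rcases Nat.lt_succ_iff_lt_or_eq.1 hy with hy | rfl
      · rw [if_neg (by omega), if_neg (by omega), gf _ (by omega) (by omega) (by omega), hl y hy]
      · rw [if_pos rfl, if_neg (by simp), g11, hc]
    · simp [Instr.step, *]
    · simp [Instr.step, *]
    · simp [Instr.step, *, add_mul, add_assoc]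
  · rintro s' ⟨h8, hf, h⟩
    exact ⟨by simp [Test.holds, h8, hf 0, h0], hf, h⟩

theorem halts_scan (h0 : s.idx 0 = n) (h1 : s.idx 1 = 1) (h19 : s.idx 19 = 32) :
    Halts d ω scan s (n * 12 + 4) fun s' =>
      (∀ j, j ≠ 10 → j ≠ 12 → j ≠ 14 → j ≠ 15 → s'.idx j = s.idx j) ∧
      s'.val 0 = minOver (entry d (s.idx 8))
        {y ∈ Finset.range n | s.idx 13 < s.idx (32 + y)} ∧
      s'.out = s.out ∧ s'.coins = s.coins := by
  refine Halts.mono (Halts.seq (T' := n * (3 + (6 + 1) + 1) + 1) (Halts.block rfl) ?_)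
    (by simp; omega) fun _ h => h
  rintro _ rfl
  refine Halts.loop (fun m s' => s'.idx 14 = m ∧
      (∀ j, j ≠ 10 → j ≠ 12 → j ≠ 14 → j ≠ 15 → s'.idx j = s.idx j) ∧
      s'.val 0 = minOver (entry d (s.idx 8))
        {y ∈ Finset.range m | s.idx 13 < s.idx (32 + y)} ∧
      -- The flag is needed because a zero in real register 0 may be a genuine minimum or the
      -- default for the empty set.
      (s'.idx 15 < 1 ↔ ({y ∈ Finset.range m | s.idx 13 < s.idx (32 + y)} : Finset ℕ) = ∅) ∧
      s'.out = s.out ∧ s'.coins = s.coins) _ ?_ ?_ ?_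
  · simp +contextual [Instr.step, minOver_empty]
  · rintro m s' hm ⟨h14, hf, hv, h15, ho, hc⟩
    refine ⟨by simpa [Test.holds, h14, hf 0, h0] using hm, ?_⟩
    have e19 : s'.idx 19 = 32 := by simp [hf, h19]
    have e1 : s'.idx 1 = 1 := by simp [hf, h1]
    have e8 : s'.idx 8 = s.idx 8 := by simp [hf]
    have e13 : s'.idx 13 = s.idx 13 := by simp [hf]
    have em : s'.idx (32 + m) = s.idx (32 + m) :=
      hf _ (by omega) (by omega) (by omega) (by omega)
    refine Halts.seq (T := 3) (Q' := fun s' => s'.idx 14 = m ∧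
      (∀ j, j ≠ 10 → j ≠ 12 → j ≠ 14 → j ≠ 15 → s'.idx j = s.idx j) ∧
      s'.val 0 = minOver (entry d (s.idx 8))
        {y ∈ Finset.range m | s.idx 13 < s.idx (32 + y)} ∧
      (s'.idx 15 < 1 ↔ ({y ∈ Finset.range m | s.idx 13 < s.idx (32 + y)} : Finset ℕ) = ∅) ∧
      s'.out = s.out ∧ s'.coins = s.coins ∧ s'.idx 10 = s.idx (32 + m) ∧
      s'.val 1 = entry d (s.idx 8) m) (Halts.block ?_) ?_
    · simp +contextual [Instr.step, *]
      rw [Function.update_of_ne (by omega), em]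
    clear! s'
    rintro s' ⟨h14, hf, hv, h15, ho, hc, h10, hw⟩
    have e1 : s'.idx 1 = 1 := by simp [hf, h1]
    have e13 : s'.idx 13 = s.idx 13 := by simp [hf]
    refine Halts.seq (T := 6) (T' := 1) (Q' := fun s' => s'.idx 14 = m ∧
      (∀ j, j ≠ 10 → j ≠ 12 → j ≠ 14 → j ≠ 15 → s'.idx j = s.idx j) ∧
      s'.val 0 = minOver (entry d (s.idx 8))
        {y ∈ Finset.range (m + 1) | s.idx 13 < s.idx (32 + y)} ∧
      (s'.idx 15 < 1 ↔
        ({y ∈ Finset.range (m + 1) | s.idx 13 < s.idx (32 + y)} : Finset ℕ) = ∅) ∧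
      s'.out = s.out ∧ s'.coins = s.coins) ?_ ?_
    · simp only [Finset.range_add_one, Finset.filter_insert]
      refine Halts.cond (T := 5) (fun hb => ?_) fun hb => ?_
      · simp only [Test.holds, e13, h10] at hb
        simp only [if_pos hb]
        refine Halts.cond (T := 4) (fun hb' => ?_) fun hb' => ?_
        · simp only [Test.holds, e1, h15] at hb'
          refine Halts.mono (Halts.block ?_) (by simp) fun _ h => h
          simp +contextual [Instr.step, *, minOver_singleton]
        · simp only [Test.holds, e1, h15] at hb'
          refine Halts.cond (T := 3) (fun hb'' => ?_) fun hb'' => ?_ <;>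
          refine Halts.mono (Halts.block ?_) (by simp) fun _ h => h <;>
          rw [minOver_insert _ _ _ (Finset.nonempty_iff_ne_empty.2 hb')] <;>
          simp only [Test.holds, hv, hw] at hb''
          · have := min_eq_left hb''.le
            simp +contextual [Instr.step, *]
          · have := min_eq_right (not_lt.1 hb'')
            simp +contextual [Instr.step, *]
      · simp only [Test.holds, e13, h10] at hb
        simp only [if_neg hb]
        refine Halts.mono (Halts.block ?_) (by simp) fun _ h => h
        simp +contextual [Instr.step, *]
    · rintro s' ⟨h14, hf, hv, h15, ho, hc⟩
      refine Halts.block ?_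
      have e1 : s'.idx 1 = 1 := by simp [hf, h1]
      simp +contextual [Instr.step, *]
  · rintro s' ⟨h14, hf, hv, h15, ho, hc⟩
    exact ⟨by simp [Test.holds, h14, hf 0, h0], hf, hv, ho, hc⟩

/-- Register 16 doubles whenever the real is halved, so the loop stops after exactly `H` halvings.
-/
theorem halts_rescale {H : ℕ} (h6 : s.idx 6 = 2 ^ H) :
    Halts d ω rescale s (H * 3 + 2) fun s' =>
      (∀ j, j ≠ 16 → s'.idx j = s.idx j) ∧ s'.val 0 = s.val 0 / 2 ^ H ∧
      s'.out = s.out ∧ s'.coins = s.coins := by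
  refine Halts.mono (Halts.seq (T' := H * (2 + 1) + 1) (Halts.block rfl) ?_)
    (by simp; omega) fun _ h => h
  rintro _ rfl
  refine Halts.loop (fun m s' => s'.idx 16 = 2 ^ m ∧ (∀ j, j ≠ 16 → s'.idx j = s.idx j) ∧
    s'.val 0 = s.val 0 / 2 ^ m ∧ s'.out = s.out ∧ s'.coins = s.coins) _ ?_ ?_ ?_
  · simp +contextual [Instr.step]
  · rintro m s' hm ⟨h16, hf, hv, ho, hc⟩
    refine ⟨?_, Halts.block ?_⟩
    · simp only [Test.holds, h16, hf 6 (by simp), h6]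
      exact Nat.pow_lt_pow_right (by simp) hm
    · simp +contextual [Instr.step, *, pow_succ, mul_two, div_div]
  · rintro s' ⟨h16, hf, h⟩
    exact ⟨by simp [Test.holds, h16, hf 6, h6], hf, h⟩

theorem halts_column {H : ℕ} (h0 : s.idx 0 = n) (h1 : s.idx 1 = 1) (h19 : s.idx 19 = 32)
    (h6 : s.idx 6 = 2 ^ H) :
    Halts d ω column s (n * (n * 12 + H * 3 + 9) + 2) fun s' =>
      (∀ j, j ≠ 8 → j ≠ 10 → j ≠ 12 → j ≠ 14 → j ≠ 15 → j ≠ 16 → s'.idx j = s.idx j) ∧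
      (∀ x < n, s'.out x (s.idx 17) = minOver (entry d x)
        {y ∈ Finset.range n | s.idx 13 < s.idx (32 + y)} / 2 ^ H) ∧
      (∀ x c, c ≠ s.idx 17 → s'.out x c = s.out x c) ∧ s'.coins = s.coins := by
  refine Halts.mono (Halts.seq (T' := n * (n * 12 + 4 + (H * 3 + 2 + 2) + 1) + 1)
    (Halts.block rfl) ?_) (by simp; linarith) fun _ h => h
  rintro _ rfl
  refine Halts.loop (fun m s' => s'.idx 8 = m ∧
      (∀ j, j ≠ 8 → j ≠ 10 → j ≠ 12 → j ≠ 14 → j ≠ 15 → j ≠ 16 → s'.idx j = s.idx j) ∧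
      (∀ x < m, s'.out x (s.idx 17) = minOver (entry d x)
        {y ∈ Finset.range n | s.idx 13 < s.idx (32 + y)} / 2 ^ H) ∧
      (∀ x c, c ≠ s.idx 17 → s'.out x c = s.out x c) ∧ s'.coins = s.coins) _ ?_ ?_ ?_
  · simp +contextual [Instr.step]
  · rintro m s' hm ⟨h8, hf, hv, ho, hc⟩
    refine ⟨by simpa [Test.holds, h8, hf 0, h0] using hm, ?_⟩
    have ef : ∀ j, s'.idx (32 + j) = s.idx (32 + j) := fun j => hf _ (by omega) (by omega)
      (by omega) (by omega) (by omega) (by omega)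
    have H₁ := halts_scan (d := d) (ω := ω) (s := s') (by simp [hf, h0]) (by simp [hf, h1])
      (by simp [hf, h19])
    refine Halts.seq H₁ ?_
    rintro s₁ ⟨gf, gv, go, gc⟩
    have H₂ := halts_rescale (d := d) (ω := ω) (s := s₁) (H := H) (by simp [gf, hf, h6])
    refine Halts.seq H₂ ?_
    rintro s₂ ⟨kf, kv, ko, kc⟩
    have k8 : s₂.idx 8 = m := by simp [kf, gf, h8]
    have k17 : s₂.idx 17 = s.idx 17 := by simp [kf, gf, hf]
    have k1 : s₂.idx 1 = 1 := by simp [kf, gf, hf, h1]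
    refine Halts.block ⟨?_, ?_, ?_, ?_, ?_⟩
    · simp [Instr.step, *]
    · intro j _ _ _ _ _ _
      simp [Instr.step, *]
    · intro x hx
      simp only [List.foldl, Instr.step, k8, k17]
      rcases Nat.lt_succ_iff_lt_or_eq.1 hx with hx | rfl
      · rw [Function.update_of_ne hx.ne, ko, go, hv x hx]
      · simp [kv, gv, h8, hf 13, ef]
    · intro x c hcc
      simp only [List.foldl, Instr.step, k8, k17]
      rcases eq_or_ne x m with rfl | hx
      · simp [hcc, ko, go, ho]
      · simp [hx, ko, go, ho x c hcc]
    · simp [Instr.step, *]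
  · rintro s' ⟨h8, hf, h⟩
    exact ⟨by simp [Test.holds, h8, hf 0, h0], hf, h⟩

theorem halts_columns {H : ℕ} (h0 : s.idx 0 = n) (h1 : s.idx 1 = 1) (h19 : s.idx 19 = 32)
    (h6 : s.idx 6 = 2 ^ H) :
    Halts d ω columns s (s.idx 3 * (n * (n * 12 + H * 3 + 9) + 5) + 2) fun s' =>
      (∀ j < 8, s'.idx j = s.idx j) ∧ s'.idx 19 = s.idx 19 ∧
      s'.idx 17 = s.idx 17 + s.idx 3 ∧
      (∀ t < s.idx 3, ∀ x < n, s'.out x (s.idx 17 + t) = minOver (entry d x)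
        {y ∈ Finset.range n | t < s.idx (32 + y)} / 2 ^ H) ∧
      (∀ x, ∀ c < s.idx 17, s'.out x c = s.out x c) ∧ s'.coins = s.coins := by
  refine Halts.mono (Halts.seq (T' := s.idx 3 * (n * (n * 12 + H * 3 + 9) + 2 + 2 + 1) + 1)
    (Halts.block rfl) ?_) (by simp; linarith) fun _ h => h
  rintro _ rfl
  refine Halts.loop (fun m s' => s'.idx 13 = m ∧ (∀ j < 8, s'.idx j = s.idx j) ∧
      s'.idx 19 = s.idx 19 ∧
      (∀ j, s'.idx (32 + j) = s.idx (32 + j)) ∧ s'.idx 17 = s.idx 17 + m ∧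
      (∀ t < m, ∀ x < n, s'.out x (s.idx 17 + t) = minOver (entry d x)
        {y ∈ Finset.range n | t < s.idx (32 + y)} / 2 ^ H) ∧
      (∀ x, ∀ c < s.idx 17, s'.out x c = s.out x c) ∧ s'.coins = s.coins) _ ?_ ?_ ?_
  · simp [Instr.step, Function.update_apply]
    exact ⟨fun j hj h => by omega, fun j h => by omega⟩
  · rintro m s' hm ⟨h13, hf, hf19, hf32, h17, hv, ho, hc⟩
    refine ⟨by simpa [Test.holds, h13, hf 3] using hm, ?_⟩
    have H₁ := halts_column (d := d) (ω := ω) (s := s') (H := H) (by simp [hf, h0])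
      (by simp [hf, h1]) (by simp [hf19, h19]) (by simp [hf, h6])
    refine Halts.seq (T' := 2) H₁ ?_
    rintro s₁ ⟨gf, gv, go, gc⟩
    refine Halts.block ⟨?_, ?_, ?_, ?_, ?_, ?_, ?_, ?_⟩
    · simp [Instr.step, *]
    · intro j hj
      simp only [List.foldl, Instr.step]
      rw [Function.update_of_ne (by omega), Function.update_of_ne (by omega),
        gf j (by omega) (by omega) (by omega) (by omega) (by omega) (by omega), hf j hj]
    · simp [Instr.step, *]
    · intro j
      simp only [List.foldl, Instr.step]
      rw [Function.update_of_ne (by omega), Function.update_of_ne (by omega),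
        gf _ (by omega) (by omega) (by omega) (by omega) (by omega) (by omega), hf32 j]
    · simp [Instr.step, *, add_assoc]
    · intro t ht x hx
      simp only [List.foldl, Instr.step]
      rcases Nat.lt_succ_iff_lt_or_eq.1 ht with ht | rfl
      · rw [go _ _ (by omega), hv t ht x hx]
      · rw [← h17, gv x hx, h13]
        simp only [hf32]
    · intro x c hc'
      simp only [List.foldl, Instr.step]
      rw [go _ _ (by omega), ho x c hc']
    · simp [Instr.step, *]
  · rintro s' ⟨h13, hf, hf19, hf32, h17, hv, ho, hc⟩
    exact ⟨by simp [Test.holds, h13, hf 3], hf, hf19, h17, hv, ho, hc⟩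

theorem halts_rounds {J R H : ℕ} (h0 : s.idx 0 = n) (h1 : s.idx 1 = 1) (h19 : s.idx 19 = 32)
    (h3 : s.idx 3 = J) (h4 : s.idx 4 = R) (h6 : s.idx 6 = 2 ^ H) (hc : s.coins = 0) :
    Halts d ω rounds s
      (R * (n * (J * 5 + 7) + J * (n * (n * 12 + H * 3 + 9) + 5) + 6) + 3) fun s' =>
      s'.idx 5 = s.idx 5 ∧
      ∀ i < R, ∀ t < J, ∀ x < n, s'.out x (i * J + t) = minOver (entry d x)
        {y ∈ Finset.range n | t < lead (fun l => ω ((i * n + y) * J + l)) J} / 2 ^ H := by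
  refine Halts.mono (Halts.seq (T' := R * (n * (J * 5 + 7) + 2 +
    (J * (n * (n * 12 + H * 3 + 9) + 5) + 2 + 1) + 1) + 1)
    (Halts.block rfl) ?_) (by simp; linarith) fun _ h => h
  rintro _ rfl
  refine Halts.loop (fun m s' => s'.idx 7 = m ∧ (∀ j < 7, s'.idx j = s.idx j) ∧
      s'.idx 19 = s.idx 19 ∧ s'.idx 17 = m * J ∧
      (∀ i < m, ∀ t < J, ∀ x < n, s'.out x (i * J + t) = minOver (entry d x)
        {y ∈ Finset.range n | t < lead (fun l => ω ((i * n + y) * J + l)) J} / 2 ^ H) ∧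
      s'.coins = m * n * J) _ ?_ ?_ ?_
  · simp [Instr.step, Function.update_apply, hc]
    intro j hj
    rw [if_neg (by omega), if_neg (by omega)]
  · rintro m s' hm ⟨h7, hf, hf19, h17, hv, hc⟩
    refine ⟨by simpa [Test.holds, h7, hf 4, h4] using hm, ?_⟩
    have H₁ := halts_sample (d := d) (ω := ω) (s := s') (by simp [hf, h0])
      (by simp [hf, h1]) (by simp [hf19, h19])
    rw [show s'.idx 3 = J by simp [hf, h3]] at H₁
    refine Halts.seq (T := n * (J * 5 + 7) + 2) H₁ ?_
    rintro s₁ ⟨gf, gl, gv, go, gc⟩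
    have H₂ := halts_columns (d := d) (ω := ω) (s := s₁) (H := H) (by simp [gf, hf, h0])
      (by simp [gf, hf, h1]) (by simp [gf, hf19, h19]) (by simp [gf, hf, h6])
    rw [show s₁.idx 3 = J by simp [gf, hf, h3], show s₁.idx 17 = m * J by simp [gf, h17]] at H₂
    refine Halts.seq (T' := 1) H₂ ?_
    rintro s₂ ⟨kf, k19, k17, kv, ko, kc⟩
    refine Halts.block ⟨?_, ?_, ?_, ?_, ?_, ?_⟩
    · simp [Instr.step, kf, gf, h7, hf, h1]
    · intro j hj
      simp only [List.foldl, Instr.step]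
      rw [Function.update_of_ne (by omega), kf j (by omega), gf j (by omega) (by omega), hf j hj]
    · simp [Instr.step, *]
    · simp [Instr.step, *, add_mul]
    · intro i hi t ht x hx
      simp only [List.foldl, Instr.step]
      rcases Nat.lt_succ_iff_lt_or_eq.1 hi with hi | rfl
      -- Columns of earlier rounds lie below those of round `m`, hence are not overwritten.
      · have : i * J + J ≤ m * J := by
          rw [← Nat.succ_mul]
          exact Nat.mul_le_mul_right _ hi
        rw [ko _ _ (by omega), go, hv i hi t ht x hx]
      · rw [kv t ht x hx]
        congr 2
        refine Finset.filter_congr fun y hy => ?_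
        rw [gl y (Finset.mem_range.1 hy), hc]
        simp only [add_mul]
    · simp [Instr.step, *, add_mul]
  · rintro s' ⟨h7, hf, hf19, h17, hv, hc⟩
    exact ⟨by simp [Test.holds, h7, hf 4, h4], hf 5 (by simp), hv⟩

theorem halts_parameters {J H : ℕ} (hJ : J = Nat.clog 2 n) (hH : H = Nat.clog 2 (256 * J * J)) :
    Halts d ω parameters (init n) (J * 771 + H * 2 + 18) fun s =>
      s.idx 0 = n ∧ s.idx 1 = 1 ∧ s.idx 19 = 32 ∧ s.idx 3 = J ∧ s.idx 4 = 256 * J ∧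
      s.idx 5 = 256 * J * J ∧ s.idx 6 = 2 ^ H ∧ s.coins = 0 := by
  refine Halts.mono (Halts.seq (T := 4)
    (T' := J * (2 + 1) + 1 + (10 + (256 * J * (2 + 1) + 1 + (1 + (H * (1 + 1) + 1)))))
    (Halts.block rfl) ?_) (by omega) fun _ h => h
  rintro _ rfl
  refine Halts.seq (Q' := fun s => s.idx 0 = n ∧ s.idx 1 = 1 ∧ s.idx 19 = 32 ∧ s.idx 3 = J ∧
    s.coins = 0) (Halts.loop (fun m s => s.idx 0 = n ∧ s.idx 1 = 1 ∧ s.idx 19 = 32 ∧ s.idx 3 = m ∧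
    s.idx 2 = 2 ^ m ∧ s.coins = 0) _ ?_ ?_ ?_) ?_
  · simp [Instr.step, init]
  · rintro m s hm ⟨h0, h1, h19, h3, h2, hc⟩
    refine ⟨?_, Halts.block ?_⟩
    · simp only [Test.holds, h0, h2]
      rwa [hJ, Nat.lt_clog_iff_pow_lt (by simp)] at hm
    · simp [Instr.step, *, pow_succ, mul_two]
  · rintro s ⟨h0, h1, h19, h3, h2, hc⟩
    refine ⟨?_, h0, h1, h19, h3, hc⟩
    simp only [Test.holds, h0, h2, hJ, not_lt]
    exact Nat.le_pow_clog (by simp) n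
  rintro s ⟨h0, h1, h19, h3, hc⟩
  refine Halts.seq (T := 10) (Halts.block rfl) ?_
  rintro _ rfl
  refine Halts.seq (Q' := fun s => s.idx 0 = n ∧ s.idx 1 = 1 ∧ s.idx 19 = 32 ∧ s.idx 3 = J ∧
    s.idx 4 = 256 * J ∧ s.idx 5 = 256 * J * J ∧ s.coins = 0)
    (Halts.loop (fun m s => s.idx 7 = m ∧ s.idx 0 = n ∧ s.idx 1 = 1 ∧ s.idx 19 = 32 ∧ s.idx 3 = J ∧
    s.idx 4 = 256 * J ∧ s.idx 5 = m * J ∧ s.coins = 0) _ ?_ ?_ ?_) ?_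
  · simp [Instr.step, *]
    omega
  · rintro m s hm ⟨h7, h0, h1, h19, h3, h4, h5, hc⟩
    refine ⟨by simpa [Test.holds, h7, h4] using hm, Halts.block ?_⟩
    simp [Instr.step, *, add_mul]
  · rintro s ⟨h7, h0, h1, h19, h3, h4, h5, hc⟩
    exact ⟨by simp [Test.holds, h7, h4], h0, h1, h19, h3, h4, h5, hc⟩
  rintro s ⟨h0, h1, h19, h3, h4, h5, hc⟩
  refine Halts.seq (T := 1) (Halts.block rfl) ?_
  rintro _ rfl
  refine Halts.loop (fun m s => s.idx 0 = n ∧ s.idx 1 = 1 ∧ s.idx 19 = 32 ∧ s.idx 3 = J ∧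
    s.idx 4 = 256 * J ∧ s.idx 5 = 256 * J * J ∧ s.idx 6 = 2 ^ m ∧ s.coins = 0) _ ?_ ?_ ?_
  · simp [Instr.step, *]
  · rintro m s hm ⟨h0, h1, h19, h3, h4, h5, h6, hc⟩
    refine ⟨?_, Halts.block ?_⟩
    · simp only [Test.holds, h5, h6]
      rwa [hH, Nat.lt_clog_iff_pow_lt (by simp)] at hm
    · simp [Instr.step, *, pow_succ, mul_two]
  · rintro s ⟨h0, h1, h19, h3, h4, h5, h6, hc⟩
    refine ⟨?_, h0, h1, h19, h3, h4, h5, h6, hc⟩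
    simp only [Test.holds, h5, h6, hH, not_lt]
    exact Nat.le_pow_clog (by simp) _

theorem halts_embed {J H : ℕ} (hJ : J = Nat.clog 2 n) (hH : H = Nat.clog 2 (256 * J * J)) :
    Halts d ω embed (init n) (J * 771 + H * 2 +
      256 * J * (n * (J * 5 + 7) + J * (n * (n * 12 + H * 3 + 9) + 5) + 6) + 23) fun s =>
      s.dim = 256 * J * J ∧
      ∀ i < 256 * J, ∀ t < J, ∀ x < n, s.out x (i * J + t) = minOver (entry d x)
        {y ∈ Finset.range n | t < lead (fun l => ω ((i * n + y) * J + l)) J} / 2 ^ H := by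
  refine Halts.mono (Halts.seq (halts_parameters hJ hH) (T' :=
    256 * J * (n * (J * 5 + 7) + J * (n * (n * 12 + H * 3 + 9) + 5) + 6) + 3 + 2) ?_) (by omega)
    fun _ h => h
  rintro s ⟨h0, h1, h19, h3, h4, h5, h6, hc⟩
  refine Halts.seq (T' := 2) (halts_rounds h0 h1 h19 h3 h4 h6 hc) ?_
  rintro s' ⟨h5', hv⟩
  refine Halts.block ?_
  simp only [List.foldl, Instr.step, State.dim]
  exact ⟨by simp [h5', h5], hv⟩

end

end RealRAM

/-! ### Distances to random sets -/

/-- The distance from `x` to `A`, or `0` if `A` is empty. -/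
noncomputable def distTo {X : Type*} [PseudoMetricSpace X] (A : Finset X) (x : X) : ℝ :=
  if h : A.Nonempty then A.inf' h (dist x) else 0

section

variable {X : Type*} [PseudoMetricSpace X]

/-- The only source of lower bounds: a set that comes close to `y` but stays away from `x` separates
the two. -/
theorem le_abs_distTo_sub {A : Finset X} {x y u : X} {a b : ℝ} (hu : u ∈ A) (ha : dist y u ≤ a)
    (hb : ∀ v ∈ A, b ≤ dist x v) : b - a ≤ |distTo A x - distTo A y| := by
  have hA : A.Nonempty := ⟨u, hu⟩
  refine le_trans ?_ (le_abs_self _)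
  simp only [distTo, dif_pos hA]
  have h1 := (Finset.inf'_le (dist y) hu).trans ha
  have h2 : b ≤ A.inf' hA (dist x) := Finset.le_inf' _ _ hb
  linarith

theorem abs_distTo_sub_le (A : Finset X) (x y : X) :
    |distTo A x - distTo A y| ≤ dist x y := by
  unfold distTo
  split_ifs with hA
  · have key : ∀ x y : X, A.inf' hA (dist x) - A.inf' hA (dist y) ≤ dist x y := by
      intro x y
      obtain ⟨u, hu, h⟩ := Finset.exists_mem_eq_inf' hA (dist y)
      rw [h]
      have := Finset.inf'_le (dist x) hu
      linarith [dist_triangle x y u]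
    rw [abs_le]
    constructor
    · linarith [key y x, dist_comm x y]
    · exact key x y
  · simp

/-- An empty level set yields the zero coordinate, which is also the distance to the whole space. So
every outcome of the coins gives a Fréchet embedding. -/
theorem exists_finset_distTo [Fintype X] [Nonempty X] (A : Finset X) :
    ∃ (B : Finset X) (hB : B.Nonempty), ∀ x, distTo A x = B.inf' hB (dist x) := by
  by_cases hA : A.Nonempty
  · exact ⟨A, hA, fun x => by simp [distTo, hA]⟩
  · refine ⟨Finset.univ, Finset.univ_nonempty, fun x => ?_⟩
    simp only [distTo, dif_neg hA]
    refine le_antisymm (Finset.le_inf' _ _ fun y _ => dist_nonneg) ?_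
    exact (Finset.inf'_le (dist x) (Finset.mem_univ x)).trans_eq (dist_self x)

variable [Fintype X]

open Classical in
-- `ρ` is the least radius at which both closed balls have `N` points, capped at `dist x y / 2`.
-- Candidates are the cap and the finitely many distances from `x` or `y`, so a minimum exists.
theorem exists_radius (x y : X) (N : ℕ) (hN : 0 < N) : ∃ ρ : ℝ, ρ ≤ dist x y / 2 ∧
    (ρ < dist x y / 2 → N ≤ (Finset.univ.filter fun z => dist x z ≤ ρ).card ∧
      N ≤ (Finset.univ.filter fun z => dist y z ≤ ρ).card) ∧
    ((Finset.univ.filter fun z => dist x z < ρ).card < N ∨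
      (Finset.univ.filter fun z => dist y z < ρ).card < N) := by
  set F : Finset ℝ := (insert (dist x y / 2) (Finset.univ.image (dist x) ∪
    Finset.univ.image (dist y))).filter fun r => r ≤ dist x y / 2 ∧ (r < dist x y / 2 →
      N ≤ (Finset.univ.filter fun z => dist x z ≤ r).card ∧
      N ≤ (Finset.univ.filter fun z => dist y z ≤ r).card) with hF
  have hne : F.Nonempty := ⟨dist x y / 2, by simp [hF]⟩
  have hmem := F.min'_mem hne
  set ρ := F.min' hne with hρ
  rw [hF, Finset.mem_filter] at hmem
  refine ⟨ρ, hmem.2.1, hmem.2.2, ?_⟩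
  -- If both open balls had `N` points, the larger of the greatest distances occurring in them would
  -- be a smaller admissible radius.
  by_contra! h
  have attained : ∀ w : X, N ≤ (Finset.univ.filter fun z => dist w z < ρ).card →
      ∃ v, dist w v < ρ ∧ ∀ z, dist w z < ρ → dist w z ≤ dist w v := by
    intro w hw
    obtain ⟨v, hv, h⟩ := Finset.exists_max_image _ (dist w) (Finset.card_pos.1 (hN.trans_le hw))
    exact ⟨v, by simpa using hv, fun z hz => h z (by simpa using hz)⟩
  obtain ⟨u, hu, hu'⟩ := attained x h.1
  obtain ⟨v, hv, hv'⟩ := attained y h.2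
  have hmem' : max (dist x u) (dist y v) ∈ F := by
    rw [hF, Finset.mem_filter]
    refine ⟨?_, (max_lt hu hv).le.trans hmem.2.1, fun _ => ⟨h.1.trans (Finset.card_le_card ?_),
      h.2.trans (Finset.card_le_card ?_)⟩⟩
    · rcases max_choice (dist x u) (dist y v) with h | h <;> simp [h]
    · intro z
      simp only [Finset.mem_filter, Finset.mem_univ, true_and]
      exact fun hz => (hu' z hz).trans (le_max_left _ _)
    · intro z
      simp only [Finset.mem_filter, Finset.mem_univ, true_and]
      exact fun hz => (hv' z hz).trans (le_max_right _ _)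
  exact absurd (F.min'_le _ hmem') (not_le.2 (max_lt hu hv))

/-- Radii `ρ 0 ≤ 0, ρ 1, …, ρ J = d(x, y) / 2` such that every set that hits one and misses another
of two suitable balls distinguishes `x` and `y` by `ρ (t + 1) - ρ t`. -/
theorem exists_radii (x y : X) (J : ℕ) (hJ : Fintype.card X ≤ 2 ^ J) : ∃ ρ : ℕ → ℝ,
    ρ 0 ≤ 0 ∧ ρ J = dist x y / 2 ∧ ∀ t, ρ (t + 1) ≤ ρ t ∨ ∃ U V : Finset X, Disjoint U V ∧
      2 ^ t ≤ U.card ∧ V.card ≤ 2 ^ (t + 1) ∧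
      ∀ A : Finset X, (∃ u ∈ U, u ∈ A) → (∀ v ∈ V, v ∉ A) →
        ρ (t + 1) - ρ t ≤ |distTo A x - distTo A y| := by
  classical
  choose ρ h1 h2 h3 using fun t : ℕ => exists_radius x y (2 ^ t) (by positivity)
  refine ⟨ρ, ?_, ?_, fun t => ?_⟩
  -- Here `N = 1`: an open ball of positive radius contains its centre.
  · by_contra! h
    have key : ∀ w : X, ¬ (Finset.univ.filter fun z => dist w z < ρ 0).card < 2 ^ 0 := by
      intro w hw
      have : w ∈ Finset.univ.filter fun z => dist w z < ρ 0 := by simpa using h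
      exact absurd (Finset.card_pos.2 ⟨w, this⟩) (by omega)
    exact (h3 0).elim (key x) (key y)
  -- Below the cap, the closed ball about `x` would have `2 ^ J` points, so be all of `X` and
  -- contain `y`.
  · refine le_antisymm (h1 J) ?_
    by_contra! h
    have h4 := Finset.eq_univ_of_card _
      (le_antisymm (Finset.card_le_univ _) (hJ.trans (h2 J h).1))
    have h5 := h4.symm ▸ Finset.mem_univ y
    simp only [Finset.mem_filter, Finset.mem_univ, true_and] at h5
    linarith [dist_nonneg (x := x) (y := y)]
  · refine or_iff_not_imp_left.2 fun h => ?_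
    rw [not_le] at h
    -- `V` is the sparse open ball of radius `ρ (t + 1)` about `a`, `U` the rich closed ball of
    -- radius `ρ t` about `b`. They are disjoint since both radii are at most half the distance.
    -- Which of `x, y` plays `a` depends on whose open ball is sparse.
    have key : ∀ a b : X, dist a b = dist x y →
        (Finset.univ.filter fun z => dist a z < ρ (t + 1)).card < 2 ^ (t + 1) →
        2 ^ t ≤ (Finset.univ.filter fun z => dist b z ≤ ρ t).card →
        ∃ U V : Finset X, Disjoint U V ∧ 2 ^ t ≤ U.card ∧ V.card ≤ 2 ^ (t + 1) ∧
        ∀ A : Finset X, (∃ u ∈ U, u ∈ A) → (∀ v ∈ V, v ∉ A) →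
          ρ (t + 1) - ρ t ≤ |distTo A a - distTo A b| := by
      intro a b hab hV hU
      refine ⟨_, _, ?_, hU, hV.le, ?_⟩
      · rw [Finset.disjoint_left]
        intro z
        simp only [Finset.mem_filter, Finset.mem_univ, true_and, not_lt]
        intro hz
        linarith [h1 (t + 1), dist_triangle a z b, dist_comm z b]
      · rintro A ⟨u, hu, huA⟩ hVA
        refine le_abs_distTo_sub huA (by simpa using hu) fun v hv => ?_
        by_contra! hv'
        exact hVA v (by simpa using hv') hv
    obtain ⟨h4, h5⟩ := h2 t (h.trans_le (h1 _))
    rcases h3 (t + 1) with h6 | h6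
    · exact key x y rfl h6 h5
    · simpa only [abs_sub_comm] using key y x (dist_comm y x) h6 h4

end

/-! ### Counting -/

/-- The sequence increases from its value 1/4 at `t = 0`, because `(1 - p / 2) ^ 2 ≥ 1 - p`. -/
theorem quarter_le_pow (t : ℕ) : (1 / 4 : ℝ) ≤ (1 - 1 / 2 ^ (t + 1)) ^ 2 ^ (t + 1) := by
  induction t with
  | zero => norm_num
  | succ t ih =>
    refine ih.trans ?_
    rw [show 2 ^ (t + 1 + 1) = 2 * 2 ^ (t + 1) by ring, pow_mul, pow_succ' (2 : ℝ) (t + 1)]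
    have h1 : (1 : ℝ) / 2 ^ (t + 1) ≤ 1 := by
      rw [div_le_one (by positivity)]
      exact one_le_pow₀ (by norm_num)
    refine pow_le_pow_left₀ (by linarith) ?_ _
    have h2 : (1 : ℝ) / (2 * 2 ^ (t + 1)) = 1 / 2 ^ (t + 1) / 2 := by
      field_simp
    rw [h2]
    nlinarith [sq_nonneg ((1 : ℝ) / 2 ^ (t + 1))]

/-- With `p = 1 / 2 ^ (t + 1)` and `m = 2 ^ t`: `(1 - p) ^ m * (1 + p) ^ m ≤ 1`, while Bernoulli
gives `(1 + p) ^ m ≥ 1 + m * p = 3 / 2`. -/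
theorem pow_le_two_thirds (t : ℕ) : (1 - 1 / 2 ^ (t + 1) : ℝ) ^ 2 ^ t ≤ 2 / 3 := by
  have h1 : (1 : ℝ) / 2 ^ (t + 1) ≤ 1 := by
    rw [div_le_one (by positivity)]
    exact one_le_pow₀ (by norm_num)
  have h0 : (0 : ℝ) < 1 / 2 ^ (t + 1) := by positivity
  have h2 : (1 - 1 / 2 ^ (t + 1) : ℝ) ^ 2 ^ t * (1 + 1 / 2 ^ (t + 1)) ^ 2 ^ t ≤ 1 := by
    rw [← mul_pow]
    exact pow_le_one₀ (mul_nonneg (by linarith) (by linarith)) (by nlinarith)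
  have h3 := one_add_mul_le_pow (a := (1 : ℝ) / 2 ^ (t + 1)) (by linarith) (2 ^ t)
  have h4 : (1 : ℝ) + ((2 ^ t : ℕ) : ℝ) * (1 / 2 ^ (t + 1)) = 3 / 2 := by
    push_cast
    rw [pow_succ]
    field_simp
    norm_num
  rw [h4] at h3
  have h5 : (0 : ℝ) ≤ (1 - 1 / 2 ^ (t + 1)) ^ 2 ^ t := pow_nonneg (by linarith) _
  nlinarith

theorem card_forall_le (J t : ℕ) (ht : t < J) :
    (Finset.univ.filter fun c : Fin J → Bool => ∀ l : Fin J, (l : ℕ) ≤ t → c l = true).card =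
      2 ^ (J - (t + 1)) := by
  have h : (Finset.univ.filter fun c : Fin J → Bool => ∀ l : Fin J, (l : ℕ) ≤ t → c l = true) =
      Fintype.piFinset fun l : Fin J => if (l : ℕ) ≤ t then {true} else Finset.univ := by
    ext c
    simp only [Finset.mem_filter, Finset.mem_univ, true_and, Fintype.mem_piFinset]
    refine forall_congr' fun l => ?_
    split_ifs with h <;> simp [h]
  rw [h, Fintype.card_piFinset]
  have h' : ∀ l : Fin J, (if (l : ℕ) ≤ t then {true} else Finset.univ : Finset Bool).card =
      if (l : ℕ) ≤ t then 1 else 2 := by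
    intro l
    split_ifs <;> simp
  simp only [h']
  rw [Finset.prod_ite, Finset.prod_const_one, one_mul, Finset.prod_const]
  congr 1
  rw [Finset.filter_not, Finset.card_sdiff_of_subset (Finset.filter_subset _ _)]
  rw [show (Finset.univ.filter fun l : Fin J => (l : ℕ) ≤ t) = Finset.Iic ⟨t, ht⟩ by
    ext l; simp [Fin.le_def]]
  simp

section

variable {X : Type*} [Fintype X]

/-- Independence in counting form: the condition restricts each point separately, so the set is a
product. -/
theorem card_forall_not (J t : ℕ) (ht : t < J) (W : Finset X) :
    open Classical in
    ((Finset.univ.filter fun β : X → Fin J → Bool =>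
      ∀ w ∈ W, ¬ ∀ l : Fin J, (l : ℕ) ≤ t → β w l = true).card : ℝ) =
      (1 - 1 / 2 ^ (t + 1)) ^ W.card * (Fintype.card (X → Fin J → Bool)) := by
  classical
  have h : (Finset.univ.filter fun β : X → Fin J → Bool =>
      ∀ w ∈ W, ¬ ∀ l : Fin J, (l : ℕ) ≤ t → β w l = true) =
      Fintype.piFinset fun w : X => if w ∈ W then
        Finset.univ.filter fun c : Fin J → Bool => ¬ ∀ l : Fin J, (l : ℕ) ≤ t → c l = true
        else Finset.univ := by
    ext β
    simp only [Finset.mem_filter, Finset.mem_univ, true_and, Fintype.mem_piFinset]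
    refine forall_congr' fun l => ?_
    split_ifs with h <;> simp [h]
  have hc : ((Finset.univ.filter fun c : Fin J → Bool =>
      ¬ ∀ l : Fin J, (l : ℕ) ≤ t → c l = true).card : ℝ) = (1 - 1 / 2 ^ (t + 1)) * 2 ^ J := by
    have h1 := Finset.card_filter_add_card_filter_not (s := Finset.univ)
      fun c : Fin J → Bool => ∀ l : Fin J, (l : ℕ) ≤ t → c l = true
    rw [card_forall_le J t ht] at h1
    have h2 : ((2 : ℝ) ^ (J - (t + 1))) * 2 ^ (t + 1) = 2 ^ J := by
      rw [← pow_add, Nat.sub_add_cancel ht]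
    have h3 : ((2 : ℝ) ^ (J - (t + 1))) + ((Finset.univ.filter fun c : Fin J → Bool =>
      ¬ ∀ l : Fin J, (l : ℕ) ≤ t → c l = true).card : ℝ) = 2 ^ J := by
      exact_mod_cast h1.trans (by simp)
    have h4 : (1 / 2 ^ (t + 1) : ℝ) * 2 ^ J = 2 ^ (J - (t + 1)) := by
      rw [← h2]
      field_simp
    rw [sub_mul, one_mul, h4]
    linarith
  rw [h, Fintype.card_piFinset]
  push_cast
  have h' : ∀ w : X, ((if w ∈ W then
        Finset.univ.filter fun c : Fin J → Bool => ¬ ∀ l : Fin J, (l : ℕ) ≤ t → c l = true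
        else Finset.univ : Finset (Fin J → Bool)).card : ℝ) =
      (if w ∈ W then (1 - 1 / 2 ^ (t + 1) : ℝ) else 1) * 2 ^ J := by
    intro w
    split_ifs
    · exact hc
    · simp
  simp only [h', Finset.prod_mul_distrib, Finset.prod_ite_mem, Finset.prod_const,
    Finset.univ_inter]
  simp

/-- Subtract those missing `U ∪ V` from those missing `V`: the proportion is `a * (1 - b)` with `a ≥
1/4` and `b ≤ 2/3`. -/
theorem card_hit_miss (J t : ℕ) (ht : t < J) (U V : Finset X) (hUV : Disjoint U V)
    (hU : 2 ^ t ≤ U.card) (hV : V.card ≤ 2 ^ (t + 1)) :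
    open Classical in
    (1 / 12 : ℝ) * Fintype.card (X → Fin J → Bool) ≤
    (Finset.univ.filter fun β : X → Fin J → Bool =>
      (∃ u ∈ U, ∀ l : Fin J, (l : ℕ) ≤ t → β u l = true) ∧
      ∀ v ∈ V, ¬ ∀ l : Fin J, (l : ℕ) ≤ t → β v l = true).card := by
  classical
  have h1 := card_forall_not J t ht V
  have h2 := card_forall_not J t ht (U ∪ V)
  rw [Finset.card_union_of_disjoint hUV, pow_add] at h2
  have h3 := Finset.card_filter_add_card_filter_not
    (s := Finset.univ.filter fun β : X → Fin J → Bool =>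
      ∀ v ∈ V, ¬ ∀ l : Fin J, (l : ℕ) ≤ t → β v l = true)
    fun β => ∃ u ∈ U, ∀ l : Fin J, (l : ℕ) ≤ t → β u l = true
  rw [Finset.filter_filter, Finset.filter_filter] at h3
  have h4 : (Finset.univ.filter fun β : X → Fin J → Bool =>
      (∀ v ∈ V, ¬ ∀ l : Fin J, (l : ℕ) ≤ t → β v l = true) ∧
      ¬ ∃ u ∈ U, ∀ l : Fin J, (l : ℕ) ≤ t → β u l = true) =
      Finset.univ.filter fun β : X → Fin J → Bool =>
      ∀ w ∈ U ∪ V, ¬ ∀ l : Fin J, (l : ℕ) ≤ t → β w l = true := by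
    ext β
    simp only [Finset.mem_filter, Finset.mem_univ, true_and, Finset.mem_union]
    constructor
    · rintro ⟨h, h'⟩ w (hw | hw) h''
      · exact h' ⟨w, hw, h''⟩
      · exact h w hw h''
    · exact fun h => ⟨fun v hv => h v (Or.inr hv), fun ⟨u, hu, h'⟩ => h u (Or.inl hu) h'⟩
  rw [h4] at h3
  have h5 : (Finset.univ.filter fun β : X → Fin J → Bool =>
      (∃ u ∈ U, ∀ l : Fin J, (l : ℕ) ≤ t → β u l = true) ∧
      ∀ v ∈ V, ¬ ∀ l : Fin J, (l : ℕ) ≤ t → β v l = true) =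
      Finset.univ.filter fun β : X → Fin J → Bool =>
      (∀ v ∈ V, ¬ ∀ l : Fin J, (l : ℕ) ≤ t → β v l = true) ∧
      ∃ u ∈ U, ∀ l : Fin J, (l : ℕ) ≤ t → β u l = true :=
    Finset.filter_congr fun β _ => and_comm
  rw [h5]
  have h6 := congrArg (Nat.cast : ℕ → ℝ) h3
  rw [Nat.cast_add, h1, h2] at h6
  have hp0 : (0 : ℝ) < 1 / 2 ^ (t + 1) := by positivity
  have hp1 : (1 : ℝ) / 2 ^ (t + 1) ≤ 1 := by
    rw [div_le_one (by positivity)]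
    exact one_le_pow₀ (by norm_num)
  have h7 : (1 / 4 : ℝ) ≤ (1 - 1 / 2 ^ (t + 1)) ^ V.card :=
    (quarter_le_pow t).trans (pow_le_pow_of_le_one (by linarith) (by linarith) hV)
  have h8 : (1 - 1 / 2 ^ (t + 1) : ℝ) ^ U.card ≤ 2 / 3 :=
    (pow_le_pow_of_le_one (by linarith) (by linarith) hU).trans (pow_le_two_thirds t)
  set a := (1 - 1 / 2 ^ (t + 1) : ℝ) ^ V.card
  set b := (1 - 1 / 2 ^ (t + 1) : ℝ) ^ U.card
  set M := (Fintype.card (X → Fin J → Bool) : ℝ)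
  have hM : 0 ≤ M := Nat.cast_nonneg _
  have h9 : (1 / 12 : ℝ) ≤ a - b * a := by nlinarith
  have h10 := mul_le_mul_of_nonneg_right h9 hM
  linarith

end

open Classical in
/-- If a twelfth of `B` is good, then few sequences have fewer than `m` good terms. -/
theorem card_few_good {B : Type*} [Fintype B] (G : B → Prop)
    (hG : (1 / 12 : ℝ) * Fintype.card B ≤ (Finset.univ.filter G).card) (R m : ℕ) :
    ((Finset.univ.filter fun f : Fin R → B =>
      (Finset.univ.filter fun i => G (f i)).card < m).card : ℝ) ≤
      2 ^ m * (23 / 24 * Fintype.card B) ^ R := by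
  -- Markov's inequality for `2^-(number of good terms)`: good terms weigh 1/2, so the average
  -- weight is at most `1 - 1/24`, weights multiply along a sequence, and a sequence with fewer than
  -- `m` good terms weighs at least `2^-m`.
  have h1 : ∑ b : B, (if G b then (1 / 2 : ℝ) else 1) ≤ 23 / 24 * Fintype.card B := by
    have h2 := Finset.card_filter_add_card_filter_not (s := Finset.univ) G
    have h3 := congrArg (Nat.cast : ℕ → ℝ) h2
    rw [Finset.card_univ, Nat.cast_add] at h3
    rw [Finset.sum_ite, Finset.sum_const, Finset.sum_const, nsmul_eq_mul, nsmul_eq_mul]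
    linarith
  have h0 : 0 ≤ ∑ b : B, (if G b then (1 / 2 : ℝ) else 1) :=
    Finset.sum_nonneg fun b _ => by split_ifs <;> norm_num
  refine le_trans ?_ (mul_le_mul_of_nonneg_left (pow_le_pow_left₀ h0 h1 R) (by positivity))
  rw [Fintype.sum_pow, Finset.mul_sum, Finset.cast_card, Finset.sum_filter]
  refine Finset.sum_le_sum fun f _ => ?_
  rw [Finset.prod_ite, Finset.prod_const_one, mul_one, Finset.prod_const, one_div, inv_pow,
    ← div_eq_mul_inv]
  split_ifs with h
  · rw [one_le_div (by positivity)]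
    exact pow_le_pow_right₀ (by norm_num) h.le
  · positivity

/-! ### From counting to coin tosses -/

namespace RealRAM

instance : IsProbabilityMeasure coinMeasure := by
  unfold coinMeasure
  infer_instance

theorem coinMeasure_cylinder {ι : Type*} [Fintype ι] (e : ι → ℕ) (he : Function.Injective e)
    (g : ι → Bool) : coinMeasure {ω | ∀ i, ω (e i) = g i} ≤ (2⁻¹ : ENNReal) ^ Fintype.card ι := by
  classical
  have h : {ω : ℕ → Bool | ∀ i, ω (e i) = g i} =
      Set.pi (Finset.univ.image e) fun j => {Function.extend e g (fun _ => true) j} := by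
    ext ω
    simp [he.extend_apply]
  rw [h, coinMeasure, Measure.infinitePi_pi _ (fun i _ => MeasurableSet.singleton _)]
  refine le_of_eq ?_
  rw [Finset.prod_congr rfl (g := fun _ => (2⁻¹ : ENNReal)), Finset.prod_const,
    Finset.card_image_of_injective _ he, Finset.card_univ]
  intro j _
  rw [PMF.toMeasure_apply_singleton _ _ (MeasurableSet.singleton _)]
  simp

/-- Only subadditivity is used, so `D` need not be measurable. -/
theorem coinMeasure_le_card {B : Type*} (D : (ℕ → Bool) → B) (c : ENNReal)
    (hD : ∀ b, coinMeasure {ω | D ω = b} ≤ c) (S : Finset B) :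
    coinMeasure {ω | D ω ∈ S} ≤ S.card * c := by
  have h : {ω | D ω ∈ S} ⊆ ⋃ b ∈ S, {ω | D ω = b} := fun ω hω => by
    simpa using hω
  refine (measure_mono h).trans ((measure_biUnion_finset_le _ _).trans ?_)
  refine (Finset.sum_le_sum fun b _ => hD b).trans ?_
  simp

end RealRAM

/-! ### Analysis of the algorithm -/

/-- Take `c₁ = c` and `c₂ = 1`. A pair realizing the diameter gives the lower bound; for the upper
one, each of the `k ≤ L` coordinates spreads a set by at most its diameter over `L`. -/
theorem isDiversityEmbedding_of_lipschitz {X : Type*} [PseudoMetricSpace X] {k : ℕ}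
    {f : X → Fin k → ℝ} {L c : ℝ} (hL : 1 ≤ L) (hk : (k : ℝ) ≤ L) (hc : 1 ≤ c)
    (hupper : ∀ x y i, |f x i - f y i| ≤ dist x y / L)
    (hlower : ∀ x y, dist x y ≤ c * ∑ i, |f x i - f y i|) :
    IsDiversityEmbedding (diamDiversity X) (l1Diversity k) f c := by
  have lower : ∀ (A : Finset X) (B : Finset (Fin k → ℝ)), (∀ a ∈ A, f a ∈ B) →
      1 / c * (diamDiversity X).δ A ≤ (l1Diversity k).δ B := by
    intro A B h
    have h0 : 0 ≤ (l1Diversity k).δ B := (l1Diversity k).nonneg _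
    rw [one_div, inv_mul_le_iff₀ (by linarith)]
    refine maxPairs_le (by positivity) fun a ha b hb => (hlower a b).trans ?_
    refine mul_le_mul_of_nonneg_left (Finset.sum_le_sum fun i _ => ?_) (by linarith)
    exact le_maxPairs (fun a b : Fin k → ℝ => |a i - b i|) (h a ha) (h b hb)
  have upper : ∀ (A : Finset X) (B : Finset (Fin k → ℝ)), (∀ b ∈ B, ∃ a ∈ A, f a = b) →
      (l1Diversity k).δ B ≤ 1 * (diamDiversity X).δ A := by
    intro A B h
    have h0 : 0 ≤ (diamDiversity X).δ A := (diamDiversity X).nonneg A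
    refine (Finset.sum_le_card_nsmul Finset.univ
      (fun i => maxPairs (fun a b : Fin k → ℝ => |a i - b i|) B)
      ((diamDiversity X).δ A / L) fun i _ => ?_).trans ?_
    · refine maxPairs_le (by positivity) fun a ha b hb => ?_
      obtain ⟨x, hx, rfl⟩ := h a ha
      obtain ⟨y, hy, rfl⟩ := h b hb
      exact (hupper x y i).trans
        (div_le_div_of_nonneg_right (le_maxPairs dist hx hy) (by linarith))
    · rw [Finset.card_univ, Fintype.card_fin, nsmul_eq_mul, mul_div_assoc',
        div_le_iff₀ (by linarith), mul_comm, one_mul]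
      gcongr
  exact ⟨c, 1, hc, le_rfl, (mul_one c).symm, fun A =>
    ⟨lower _ _ fun a ha => by
      simp only [Finset.mem_image]
      exact ⟨a, ha, rfl⟩, upper _ _ fun b hb => by
      simpa using hb⟩⟩

/-- For `n ≥ 2`, rounding up adds at most one binary logarithm, so the factor is at most `2 / log 2
< 3`. -/
theorem clog_le_three_mul_log (n : ℕ) : (Nat.clog 2 n : ℝ) ≤ 3 * Real.log n := by
  rcases le_or_gt n 1 with hn | hn
  · rw [Nat.clog_of_right_le_one hn]
    interval_cases n <;> simp
  · have h1 := Nat.pow_pred_clog_lt_self (b := 2) (by simp) hn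
    have h2 : ((2 : ℝ) ^ (Nat.clog 2 n - 1)) ≤ n := by exact_mod_cast h1.le
    have h3 := Real.log_le_log (by positivity) h2
    have hpos := Nat.clog_pos (b := 2) (by simp) hn
    rw [Real.log_pow, Nat.cast_sub hpos, Nat.cast_one] at h3
    have h4 : Real.log 2 ≤ Real.log n := Real.log_le_log (by simp) (by exact_mod_cast hn)
    have h5 := Real.log_two_gt_d9
    have h6 : (1 : ℝ) ≤ Nat.clog 2 n := by exact_mod_cast hpos
    nlinarith

theorem two_pow_clog_le (k : ℕ) : 2 ^ Nat.clog 2 k ≤ max 1 (2 * k) := by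
  rcases le_or_gt k 1 with hk | hk
  · simp [Nat.clog_of_right_le_one hk]
  · have h1 := Nat.pow_pred_clog_lt_self (b := 2) (by simp) hk
    have hpos := Nat.clog_pos (b := 2) (by simp) hk
    obtain ⟨m, hm⟩ := Nat.exists_eq_succ_of_ne_zero hpos.ne'
    rw [hm] at h1 ⊢
    simp only [Nat.succ_eq_add_one, Nat.pred_succ, pow_succ] at h1 ⊢
    omega

theorem clog_two_le (n : ℕ) : Nat.clog 2 n ≤ n :=
  Nat.clog_le_of_le_pow Nat.lt_two_pow_self.le

theorem eq_of_mul_add_eq {J a b l m : ℕ} (hl : l < J) (hm : m < J)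
    (h : a * J + l = b * J + m) : a = b ∧ l = m := by
  have h1 := congrArg (· / J) h
  have h2 := congrArg (· % J) h
  simp only [mul_comm _ J, Nat.mul_add_div (by omega : J > 0), Nat.mul_add_mod,
    Nat.div_eq_of_lt hl, Nat.div_eq_of_lt hm, Nat.mod_eq_of_lt hl, Nat.mod_eq_of_lt hm] at h1 h2
  omega

theorem sum_range_mul (R J : ℕ) (g : ℕ → ℝ) :
    ∑ c ∈ Finset.range (R * J), g c =
      ∑ i ∈ Finset.range R, ∑ t ∈ Finset.range J, g (i * J + t) := by
  induction R with
  | zero => simp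
  | succ R ih => rw [add_mul, one_mul, Finset.sum_range_add, ih, Finset.sum_range_succ]

/-! ### The output as distances to random level sets, and the union bound -/

namespace RealRAM

theorem minOver_image {X : Type*} (w : ℕ → ℝ) (φ : X → ℕ) (A : Finset X) :
    minOver w (A.image φ) = if h : A.Nonempty then A.inf' h (w ∘ φ) else 0 := by
  unfold minOver
  by_cases h : A.Nonempty
  · rw [dif_pos (h.image φ), dif_pos h, Finset.inf'_image]
  · rw [Finset.not_nonempty_iff_eq_empty.1 h]
    simp

/-- The coin tosses of the round `i`: `J` of them for each point. -/
def roundCoins {X : Type*} {n : ℕ} (e : X ≃ Fin n) (J : ℕ) (ω : ℕ → Bool) (i : ℕ) :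
    X → Fin J → Bool :=
  fun x l => ω ((i * n + e x) * J + l)

section

variable {X : Type*} [Fintype X]

/-- The points whose first `t + 1` coins are all heads. -/
def levelSet {J : ℕ} (β : X → Fin J → Bool) (t : ℕ) : Finset X :=
  Finset.univ.filter fun x => ∀ l : Fin J, (l : ℕ) ≤ t → β x l = true

theorem mem_levelSet {J : ℕ} {β : X → Fin J → Bool} {t : ℕ} {x : X} :
    x ∈ levelSet β t ↔ ∀ l : Fin J, (l : ℕ) ≤ t → β x l = true := by
  simp [levelSet]

/-- Distinct triples (round, point, coin) read distinct tosses, by uniqueness of division with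
remainder. -/
theorem coinMeasure_roundCoins_le {n : ℕ} (e : X ≃ Fin n) (J R : ℕ)
    (b : Fin R → X → Fin J → Bool) :
    coinMeasure {ω | (fun i : Fin R => roundCoins e J ω i) = b} ≤
      (2⁻¹ : ENNReal) ^ (R * (Fintype.card X * J)) := by
  have h := coinMeasure_cylinder
    (fun p : Fin R × X × Fin J => ((p.1 : ℕ) * n + e p.2.1) * J + p.2.2) ?_
    (fun p => b p.1 p.2.1 p.2.2)
  · simp only [Fintype.card_prod, Fintype.card_fin] at h
    refine (measure_mono ?_).trans h
    rintro ω rfl ⟨i, x, l⟩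
    rfl
  · rintro ⟨i, x, l⟩ ⟨i', x', l'⟩ h
    obtain ⟨h1, h2⟩ := eq_of_mul_add_eq l.2 l'.2 h
    obtain ⟨h3, h4⟩ := eq_of_mul_add_eq (e x).2 (e x').2 h1
    exact Prod.ext (Fin.ext h3) (Prod.ext (e.injective (Fin.ext h4)) (Fin.ext h2))

open Classical in
theorem coinMeasure_few_good_le {n : ℕ} (e : X ≃ Fin n) (J : ℕ) (G : (X → Fin J → Bool) → Prop)
    (hG : (1 / 12 : ℝ) * Fintype.card (X → Fin J → Bool) ≤ (Finset.univ.filter G).card) :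
    coinMeasure {ω | (Finset.univ.filter fun i : Fin (256 * J) =>
      G (roundCoins e J ω i)).card < 8 * J} ≤ ENNReal.ofReal ((1 / 32) ^ J) := by
  have h1 := card_few_good G hG (256 * J) (8 * J)
  have h2 := coinMeasure_le_card (fun ω => fun i : Fin (256 * J) => roundCoins e J ω i) _
    (coinMeasure_roundCoins_le e J (256 * J)) (Finset.univ.filter fun f =>
      (Finset.univ.filter fun i => G (f i)).card < 8 * J)
  simp only [Finset.mem_filter, Finset.mem_univ, true_and] at h2
  refine h2.trans ?_
  rw [show (2⁻¹ : ENNReal) = ENNReal.ofReal 2⁻¹ by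
      rw [ENNReal.ofReal_inv_of_pos (by simp), ENNReal.ofReal_ofNat],
    ← ENNReal.ofReal_pow (by positivity), ← ENNReal.ofReal_natCast,
    ← ENNReal.ofReal_mul (by positivity)]
  refine ENNReal.ofReal_le_ofReal ((mul_le_mul_of_nonneg_right h1 (by positivity)).trans ?_)
  have h3 : (Fintype.card (X → Fin J → Bool) : ℝ) = 2 ^ (Fintype.card X * J) := by
    simp [← pow_mul, mul_comm]
  -- The number of outcomes cancels against the probability of each, leaving `(2 ^ 8 * (23 / 24) ^
  -- 256) ^ J`, whose base is below 1/32.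
  rw [h3, mul_comm (256 * J) (Fintype.card X * J), pow_mul (2⁻¹ : ℝ), mul_assoc, ← mul_pow,
    mul_assoc (23 / 24 : ℝ), ← mul_pow, mul_inv_cancel₀ (by norm_num), one_pow, mul_one, pow_mul,
    pow_mul, ← mul_pow]
  exact pow_le_pow_left₀ (by positivity) (by norm_num) J

variable [PseudoMetricSpace X]

theorem minOver_eq_distTo {n : ℕ} (e : X ≃ Fin n) (J : ℕ) (ω : ℕ → Bool) (i t : ℕ) (ht : t < J)
    (x : X) : minOver (entry (fun i j => dist (e.symm i) (e.symm j)) (e x))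
      {y ∈ Finset.range n | t < lead (fun l => ω ((i * n + y) * J + l)) J} =
      distTo (levelSet (roundCoins e J ω i) t) x := by
  have h1 : ({y ∈ Finset.range n | t < lead (fun l => ω ((i * n + y) * J + l)) J} : Finset ℕ) =
      (levelSet (roundCoins e J ω i) t).image fun x => (e x : ℕ) := by
    ext y
    simp only [Finset.mem_filter, Finset.mem_range, Finset.mem_image, mem_levelSet,
      (lead_spec _ J).2 t ht, roundCoins]
    constructor
    · rintro ⟨hy, h⟩
      exact ⟨e.symm ⟨y, hy⟩, fun l hl => by simpa using h l hl, by simp⟩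
    · rintro ⟨x, h, rfl⟩
      exact ⟨(e x).2, fun m hm => h ⟨m, by omega⟩ hm⟩
  rw [h1, minOver_image, distTo]
  have h2 : (entry (fun i j => dist (e.symm i) (e.symm j)) (e x)) ∘ (fun x => (e x : ℕ)) =
      dist x := by
    ext y
    simp [entry]
  rw [h2]

theorem halts_embed_distTo {n J H : ℕ} (e : X ≃ Fin n) (hJ : J = Nat.clog 2 n)
    (hH : H = Nat.clog 2 (256 * J * J)) (ω : ℕ → Bool) :
    Halts (fun i j => dist (e.symm i) (e.symm j)) ω embed (init n) (n * 771 + 256 * n * n * 2 +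
      256 * n * (n * (n * 5 + 7) + n * (n * (n * 12 + 256 * n * n * 3 + 9) + 5) + 6) + 23) fun s =>
      s.dim = 256 * J * J ∧ ∀ i < 256 * J, ∀ t < J, ∀ x, s.out (e x) (i * J + t) =
        distTo (levelSet (roundCoins e J ω i) t) x / 2 ^ H := by
  refine (halts_embed hJ hH).mono ?_ ?_
  · have h1 : J ≤ n := hJ ▸ clog_two_le n
    have h2 : H ≤ 256 * n * n := by
      rw [hH]
      exact (clog_two_le _).trans (by gcongr)
    gcongr
  · rintro s ⟨hd, h⟩
    refine ⟨hd, fun i hi t ht x => ?_⟩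
    rw [h i hi t ht _ (e x).2, minOver_eq_distTo e J ω i t ht x]

/-- The distance of `x` and `y` is visible in many rounds, on every level. -/
theorem dist_le_sum {J R m : ℕ} (B : Fin R → X → Fin J → Bool) (x y : X) (ρ : ℕ → ℝ)
    (h0 : ρ 0 ≤ 0) (hJ : ρ J = dist x y / 2)
    (h : open Classical in ∀ t < J, m ≤ (Finset.univ.filter fun i => ρ (t + 1) - ρ t ≤
      |distTo (levelSet (B i) t) x - distTo (levelSet (B i) t) y|).card) :
    m * (dist x y / 2) ≤ ∑ i, ∑ t ∈ Finset.range J,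
      |distTo (levelSet (B i) t) x - distTo (levelSet (B i) t) y| := by
  classical
  have h1 : dist x y / 2 ≤ ∑ t ∈ Finset.range J, (ρ (t + 1) - ρ t) := by
    rw [Finset.sum_range_sub, hJ]
    linarith
  refine (mul_le_mul_of_nonneg_left h1 (Nat.cast_nonneg m)).trans ?_
  rw [Finset.mul_sum, Finset.sum_comm]
  refine Finset.sum_le_sum fun t ht => ?_
  have h2 := h t (Finset.mem_range.1 ht)
  -- The increments telescope to at least `dist x y / 2`; nonpositive ones cost nothing.
  rcases le_total (ρ (t + 1) - ρ t) 0 with h3 | h3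
  · exact (mul_nonpos_of_nonneg_of_nonpos (Nat.cast_nonneg m) h3).trans
      (Finset.sum_nonneg fun i _ => abs_nonneg _)
  · refine le_trans ?_ (Finset.sum_le_sum_of_subset_of_nonneg (Finset.filter_subset
      (fun i => ρ (t + 1) - ρ t ≤
        |distTo (levelSet (B i) t) x - distTo (levelSet (B i) t) y|) _)
      fun i _ _ => abs_nonneg _)
    refine le_trans ?_ (Finset.card_nsmul_le_sum _ _ _ fun i hi => (Finset.mem_filter.1 hi).2)
    rw [nsmul_eq_mul]
    exact mul_le_mul_of_nonneg_right (by exact_mod_cast h2) h3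

/-- With high probability, the distances of all pairs of points are visible in the sum of the
coordinates. -/
theorem coinMeasure_dist_le_sum {n J : ℕ} (e : X ≃ Fin n) (hJ : J = Nat.clog 2 n) :
    ENNReal.ofReal (1 - 1 / (n + 1)) ≤ coinMeasure {ω | ∀ x y : X,
      ((8 * J : ℕ) : ℝ) * (dist x y / 2) ≤ ∑ i : Fin (256 * J), ∑ t ∈ Finset.range J,
      |distTo (levelSet (roundCoins e J ω i) t) x - distTo (levelSet (roundCoins e J ω i) t) y|} := by
  classical
  have hcard : Fintype.card X = n := by simpa using Fintype.card_congr e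
  have hn : n ≤ 2 ^ J := hJ ▸ Nat.le_pow_clog (by simp) n
  choose ρ h0 h1 h2 using fun p : X × X => exists_radii p.1 p.2 J (hcard ▸ hn)
  obtain ⟨good, hgood⟩ : ∃ good : X × X → ℕ → (X → Fin J → Bool) → Prop, ∀ p t β,
    good p t β ↔ ρ p (t + 1) - ρ p t ≤ |distTo (levelSet β t) p.1 - distTo (levelSet β t) p.2| :=
    ⟨_, fun _ _ _ => Iff.rfl⟩
  have hG : ∀ p, ∀ t < J, (1 / 12 : ℝ) * Fintype.card (X → Fin J → Bool) ≤
      (Finset.univ.filter (good p t)).card := by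
    intro p t ht
    rcases h2 p t with h | ⟨U, V, hUV, hU, hV, h⟩
    · rw [Finset.filter_true_of_mem fun β _ =>
        (hgood _ _ _).2 ((sub_nonpos.2 h).trans (abs_nonneg _)), Finset.card_univ]
      have : (0 : ℝ) ≤ Fintype.card (X → Fin J → Bool) := Nat.cast_nonneg _
      linarith
    · refine (card_hit_miss J t ht U V hUV hU hV).trans ?_
      refine Nat.cast_le.2 (Finset.card_le_card fun β => ?_)
      simp only [Finset.mem_filter, Finset.mem_univ, true_and]
      rintro ⟨⟨u, hu, hu'⟩, hV'⟩
      exact (hgood _ _ _).2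
        (h _ ⟨u, hu, mem_levelSet.2 hu'⟩ fun v hv hv' => hV' v hv (mem_levelSet.1 hv'))
  obtain ⟨bad, hbad⟩ : ∃ bad : X × X → ℕ → Set (ℕ → Bool), ∀ p t, bad p t =
    {ω | (Finset.univ.filter fun i : Fin (256 * J) => good p t (roundCoins e J ω i)).card <
      8 * J} := ⟨_, fun _ _ => rfl⟩
  -- Covering the whole space, rather than taking a complement, avoids any measurability question.
  have hsub : Set.univ ⊆ {ω | ∀ x y : X,
      ((8 * J : ℕ) : ℝ) * (dist x y / 2) ≤ ∑ i : Fin (256 * J), ∑ t ∈ Finset.range J,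
      |distTo (levelSet (roundCoins e J ω i) t) x -
        distTo (levelSet (roundCoins e J ω i) t) y|} ∪
      ⋃ p ∈ (Finset.univ ×ˢ Finset.range J : Finset ((X × X) × ℕ)), bad p.1 p.2 := by
    rintro ω -
    by_cases hω : ω ∈ ⋃ p ∈ (Finset.univ ×ˢ Finset.range J : Finset ((X × X) × ℕ)), bad p.1 p.2
    · exact Or.inr hω
    · refine Or.inl fun x y => dist_le_sum (fun i => roundCoins e J ω i) x y (ρ (x, y)) (h0 _)
        (h1 _) fun t ht => ?_
      by_contra hlt
      refine hω (Set.mem_biUnion (x := ((x, y), t)) (by simpa using ht) ?_)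
      simpa [hbad, hgood] using hlt
  have hbound : coinMeasure (⋃ p ∈ (Finset.univ ×ˢ Finset.range J : Finset ((X × X) × ℕ)),
      bad p.1 p.2) ≤ ENNReal.ofReal (1 / (n + 1)) := by
    refine (measure_biUnion_finset_le _ _).trans ?_
    refine (Finset.sum_le_card_nsmul _ _ _ fun p hp => hbad p.1 p.2 ▸ coinMeasure_few_good_le e J (good p.1 p.2)
      (hG p.1 p.2 (by simpa using hp))).trans ?_
    rw [nsmul_eq_mul, ← ENNReal.ofReal_natCast, ← ENNReal.ofReal_mul (by positivity)]
    refine ENNReal.ofReal_le_ofReal ?_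
    rw [Finset.card_product, Finset.card_univ, Fintype.card_prod, hcard, Finset.card_range,
      le_div_iff₀ (by positivity), one_div_pow, mul_one_div, div_mul_eq_mul_div,
      div_le_one (by positivity)]
    -- There are `n² J` bad events of probability at most `32^-J`. Each of `n`, `n`, `J` is at most
    -- `2 ^ J`, and `n + 1 ≤ 4 ^ J` once `J > 0`; for `J = 0` there are no levels.
    rcases Nat.eq_zero_or_pos J with hJ0 | hJ0
    · simp [hJ0]
    · have h3 : J ≤ 2 ^ J := Nat.lt_two_pow_self.le
      have h4 : n + 1 ≤ 2 ^ J * 2 ^ J := by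
        have : 2 ≤ 2 ^ J := Nat.le_self_pow hJ0.ne' 2
        nlinarith
      have h5 : n * n * J * (n + 1) ≤ 32 ^ J := by
        calc n * n * J * (n + 1) ≤ 2 ^ J * 2 ^ J * 2 ^ J * (2 ^ J * 2 ^ J) := by gcongr
          _ = 32 ^ J := by
            rw [← mul_pow, ← mul_pow, ← mul_pow]
            norm_num
      exact_mod_cast h5
  have h6 := (measure_mono (μ := coinMeasure) hsub).trans (measure_union_le _ _)
  rw [measure_univ] at h6
  rw [ENNReal.ofReal_sub _ (by positivity), ENNReal.ofReal_one]
  exact tsub_le_iff_right.2 (h6.trans (by gcongr))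

end

end RealRAM

/-! ### Assembly of the theorem -/

theorem mainTheorem3 :
    ∃ (p : RealRAM.Program) (T : Polynomial ℕ) (C : ℝ), 0 < C ∧
      ∀ (X : Type*) [PseudoMetricSpace X] (n : ℕ) (e : X ≃ Fin n),
        (∀ ω : ℕ → Bool, ∃ (t : ℕ) (s : RealRAM.State),
          RealRAM.Exec (fun i j => dist (e.symm i) (e.symm j)) ω p (RealRAM.init n) t s ∧
          t ≤ T.eval n ∧
          (s.dim : ℝ) ≤ C * Real.log n ^ 2 ∧
          ∃ L : ℝ, 1 ≤ L ∧ (s.dim : ℝ) ≤ L ∧ L ≤ max 1 (C * Real.log n ^ 2) ∧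
            IsScaledFrechet (1 / L) (s.map e)) ∧
        ENNReal.ofReal (1 - 1 / (n + 1)) ≤ RealRAM.coinMeasure
          {ω | ∃ (t : ℕ) (s : RealRAM.State),
            RealRAM.Exec (fun i j => dist (e.symm i) (e.symm j)) ω p (RealRAM.init n) t s ∧
            ∃ c : ℝ, c ≤ max 1 (C * Real.log n) ∧
              IsDiversityEmbedding (diamDiversity X) (l1Diversity s.dim) (s.map e) c} := by
  open Polynomial in
  refine ⟨RealRAM.embed, X * 771 + 256 * X * X * 2 +
      256 * X * (X * (X * 5 + 7) + X * (X * (X * 12 + 256 * X * X * 3 + 9) + 5) + 6) + 23,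
    -- `J ≤ 3 log n` bounds the dimension by `2304 log² n`, and rounding up to a power of two
    -- doubles this. The distortion `128 * J` needs only 384.
    4608, by norm_num, ?_⟩
  intro X _ n e
  have : Fintype X := Fintype.ofEquiv _ e.symm
  obtain ⟨J, hJ⟩ : ∃ J, J = Nat.clog 2 n := ⟨_, rfl⟩
  obtain ⟨H, hH⟩ : ∃ H, H = Nat.clog 2 (256 * J * J) := ⟨_, rfl⟩
  have hlog : (J : ℝ) ≤ 3 * Real.log n := hJ ▸ clog_le_three_mul_log n
  have hdim : ((256 * J * J : ℕ) : ℝ) ≤ 2304 * Real.log n ^ 2 := by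
    push_cast
    nlinarith [Nat.cast_nonneg (α := ℝ) J]
  have hL1 : (1 : ℝ) ≤ 2 ^ H := one_le_pow₀ (by norm_num)
  have hLdim : ((256 * J * J : ℕ) : ℝ) ≤ 2 ^ H := by
    rw [hH]
    exact_mod_cast Nat.le_pow_clog (by simp) _
  have hLmax : (2 : ℝ) ^ H ≤ max (1 : ℝ) (2 * ((256 * J * J : ℕ) : ℝ)) := by
    rw [hH]
    exact_mod_cast two_pow_clog_le _
  have coord : ∀ (ω : ℕ → Bool) (s : RealRAM.State), s.dim = 256 * J * J →
      (∀ i < 256 * J, ∀ t < J, ∀ x, s.out (e x) (i * J + t) =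
        distTo (RealRAM.levelSet (RealRAM.roundCoins e J ω i) t) x / 2 ^ H) →
      ∀ c : Fin s.dim, ∃ A : Finset X, ∀ x, s.map e x c = distTo A x / 2 ^ H := by
    intro ω s hd h c
    have hc : (c : ℕ) < 256 * J * J := hd ▸ c.2
    have hJ0 : 0 < J := by
      by_contra h0
      rw [Nat.eq_zero_of_not_pos h0] at hc
      simp at hc
    refine ⟨RealRAM.levelSet (RealRAM.roundCoins e J ω (c / J)) (c % J), fun x => ?_⟩
    rw [← h (c / J) (Nat.div_lt_of_lt_mul (by rwa [mul_comm])) (c % J) (Nat.mod_lt _ hJ0),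
      Nat.div_add_mod']
    rfl
  constructor
  · intro ω
    obtain ⟨t, s, hexec, ht, hd, hs⟩ := RealRAM.halts_embed_distTo e hJ hH ω
    refine ⟨t, s, hexec, by simpa using ht, ?_, 2 ^ H, hL1, by rwa [hd], ?_, ?_⟩
    · rw [hd]
      nlinarith [sq_nonneg (Real.log n)]
    · refine hLmax.trans (max_le_max le_rfl ?_)
      linarith
    · intro c
      obtain ⟨A, hA⟩ := coord ω s hd hs c
      have : Nonempty X := by
        by_contra hX
        rw [not_nonempty_iff] at hX
        have hn : n = 0 := by simpa using (Fintype.card_congr e).symm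
        have hc : (c : ℕ) < 256 * J * J := hd ▸ c.2
        have hJ0 : J = 0 := by simp [hJ, hn]
        simp [hJ0] at hc
      obtain ⟨B, hB, hAB⟩ := exists_finset_distTo A
      exact ⟨B, hB, fun x => by rw [hA, hAB, one_div, div_eq_inv_mul]⟩
  · refine (RealRAM.coinMeasure_dist_le_sum e hJ).trans (measure_mono fun ω hω => ?_)
    obtain ⟨t, s, hexec, -, hd, hs⟩ := RealRAM.halts_embed_distTo e hJ hH ω
    refine ⟨t, s, hexec, max 1 (128 * J), max_le_max le_rfl (by linarith), ?_⟩
    refine isDiversityEmbedding_of_lipschitz hL1 (by rwa [hd]) (le_max_left _ _) ?_ ?_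
    · intro x y c
      obtain ⟨A, hA⟩ := coord ω s hd hs c
      rw [hA, hA, ← sub_div, abs_div, abs_of_pos (by positivity : (0 : ℝ) < 2 ^ H)]
      gcongr
      exact abs_distTo_sub_le A x y
    · intro x y
      have hsum : ∑ c, |s.map e x c - s.map e y c| = (∑ i : Fin (256 * J),
          ∑ t ∈ Finset.range J, |distTo (RealRAM.levelSet (RealRAM.roundCoins e J ω i) t) x -
          distTo (RealRAM.levelSet (RealRAM.roundCoins e J ω i) t) y|) / 2 ^ H := by
        unfold RealRAM.State.map
        rw [Fin.sum_univ_eq_sum_range (fun c => |s.out (e x) c - s.out (e y) c|) s.dim, hd,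
          sum_range_mul, Finset.sum_range, Finset.sum_div]
        refine Finset.sum_congr rfl fun i _ => ?_
        rw [Finset.sum_div]
        refine Finset.sum_congr rfl fun t ht => ?_
        rw [hs i i.2 t (Finset.mem_range.1 ht), hs i i.2 t (Finset.mem_range.1 ht), ← sub_div,
          abs_div, abs_of_pos (by positivity : (0 : ℝ) < 2 ^ H)]
      rw [hsum]
      have hxy := hω x y
      -- For `J = 0` there are no coordinates, but then at most one point. Otherwise `L ≤ 512 J²`,
      -- and the sum `4 J d(x, y)` over `L` is at least `d(x, y) / (128 J)`.
      rcases Nat.eq_zero_or_pos J with hJ0 | hJ0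
      · have hn : n ≤ 1 := by
          simpa [← hJ, hJ0] using Nat.le_pow_clog (b := 2) (by simp) n
        have : x = y := e.injective (Fin.ext (by have := (e x).2; have := (e y).2; omega))
        rw [this, dist_self]
        positivity
      · have hJ1 : (1 : ℝ) ≤ J := by exact_mod_cast hJ0
        have hL : (2 : ℝ) ^ H ≤ 512 * J * J := by
          refine hLmax.trans (max_le (by nlinarith) ?_)
          push_cast
          linarith
        rw [max_eq_right (by linarith), mul_div_assoc', le_div_iff₀ (by positivity)]
        push_cast at hxy
        have h1 := mul_le_mul_of_nonneg_left hL (dist_nonneg (x := x) (y := y))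
        have h2 := mul_le_mul_of_nonneg_left hxy (by positivity : (0 : ℝ) ≤ 128 * J)
        linarith
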